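/- Let $N>1$ be a square-free integer, $k$ an even integer, $z=x+iy$ with $y>0$, and $s\in\mathbb C$ with $\Re(s)>1-\frac k2$. Put $$(\mathbb Z\times\mathbb Z)_{N,L}=\bigsqcup_{t>0}\{(m,n)\in t\mathbb Z\times t\mathbb Z:\gcd(Nm,n)=t\},\qquad (\mathbb Z\times\mathbb Z)_{N,R}=\bigsqcup_{t>0}\{(m,n)\in t\mathbb Z\times t\mathbb Z:\gcd(m,Nn)=t\},$$ $$G_{N,k}(z,s)=\frac12\sum_{(m,n)\in(\mathbb Z\times\mathbb Z)_{N,L}}\frac{y^s}{|\sqrt N mz+n|^{2s}(\sqrt N mz+n)^k}+\frac12\sum_{(m,n)\in(\mathbb Z\times\mathbb Z)_{N,R}}\frac{y^s}{|mz+\sqrt N n|^{2s}(mz+\sqrt N n)^k}.$$ For a non-zero integer $b$ let $$f_{N,b}(s)=\frac{N^{-(s-1)-\frac k2}\prod_{p\mid N}\left(\sum_{i=1}^{v_p(b)}(p-1)p^{i-1+i(2s+k-2)}-p^{v_p(b)+(v_p(b)+1)(2s+k-2)}\right)+1}{\prod_{p\mid N}\zeta_p(-2s-k+2)^{-1}\,\zeta_p(-2s-k+1;v_p(b))},\qquad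 f_N=f_{N,1},$$ where the products are over primes $p$, $v_p$ is the $p$-adic valuation, $\zeta_p(w)=(1-p^{-w})^{-1}$ and $\zeta_p(w;v)=\sum_{n=0}^{v}p^{-nw}$. Let $$\widehat G_{N,k}(z,s)=\left(\frac{\pi}{\sqrt N}\right)^{-s-\frac k2}\Gamma\left(s+\frac k2+\frac{|k|}2\right)f_N(s)\,G_{N,k}(z,s).$$ Let $\hat\zeta(w)=\pi^{-w/2}\Gamma(\frac w2)\zeta(w)$ be the completed Riemann zeta function (as a meromorphic function), $\sigma_\nu(n)=\sum_{d\mid n,\,d>0}d^\nu$, and for $y>0$ let $W_{\kappa,\mu}(y)$ be the Whittaker function, that is, the entire function of $\kappa$ which for $\Re(\mu+\frac12-\kappa)>0$ is given by $$W_{\kappa,\mu}(y)=\frac{y^{\frac12-\mu}e^{-y/2}}{\Gamma(\mu+\frac12-\kappa)}\int_0^\infty e^{-u}u^{\mu-\kappa-\frac12}(u+y)^{\mu+\kappa-\frac12}\,du.$$ Then both series defining $G_{N,k}(z,s)$ converge absolutely, the series over $n\ne0$ below converges absolutely, and $\widehat G_{N,k}(z,s)$ has the Fourier expansion \begin{align*}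 \widehat G_{N,k}(z,s)=&\ \frac{\Gamma(s+\frac k2+\frac{|k|}2)}{\Gamma(s+\frac k2)}\hat\zeta(2s+k)\,y^s\sqrt N^{\,s+\frac k2}f_N(s)\\ &+(-1)^{k/2}\frac{\Gamma(s+\frac k2)\Gamma(s+\frac k2+\frac{|k|}2)}{\Gamma(s+k)\Gamma(s)}\hat\zeta(2-k-2s)\,y^{1-k-s}f_N(s)\\ &\qquad\times\left(\sqrt N^{\,1-s-\frac k2}\prod_{p\mid N}\frac{1-p^{-1}}{1-p^{-2s-k}}+\sqrt N^{\,-1+s+\frac k2}\prod_{p\mid N}\frac{1-p^{1-k-2s}}{1-p^{-2s-k}}\right)\\ &+\sum_{n\ne0}(-1)^{k/2}y^{-k/2}\,\frac{\Gamma(s+\frac k2+\frac{|k|}2)}{\Gamma(s+\frac k2+\mathrm{sgn}(n)\frac k2)}\,|n|^{-s-\frac k2}\sigma_{2s+k-1}(n)\,W_{\mathrm{sgn}(n)\frac k2,\,s+\frac{k-1}2}\left(4\pi|n|\frac{y}{\sqrt N}\right)\\ &\qquad\times f_{N,n}(1-k-s)\,f_N(s)\,e^{2\pi inx/\sqrt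 N}, \end{align*} where $1/\Gamma$ is read as an entire function (it is $0$ at the poles of $\Gamma$). -/

import Mathlib

noncomputable section

namespace RNEisenstein

/-! ### The Whittaker function -/

/-- The integral representation of the Whittaker function `W_{κ,μ}(y)`, `y > 0`, valid for
`Re κ < Re μ + 1/2`:
`y^{1/2-μ} e^{-y/2} / Γ(μ+1/2-κ) * ∫_0^∞ e^{-u} u^{μ-κ-1/2} (u+y)^{μ+κ-1/2} du`. -/
def whittakerIntegral (κ μ : ℂ) (y : ℝ) : ℂ :=
  (y : ℂ) ^ (1 / 2 - μ) * Complex.exp (-(y : ℂ) / 2) / Complex.Gamma (μ + 1 / 2 - κ) *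
    ∫ u in Set.Ioi (0 : ℝ),
      Complex.exp (-(u : ℂ)) * (u : ℂ) ^ (μ - κ - 1 / 2) * ((u : ℂ) + (y : ℂ)) ^ (μ + κ - 1 / 2)

/-- `F` is an entire function of `κ` which agrees with the integral representation of
`κ ↦ W_{κ,μ}(y)` on the half plane where the latter converges. -/
def IsWhittakerContinuation (μ : ℂ) (y : ℝ) (F : ℂ → ℂ) : Prop :=
  Differentiable ℂ F ∧ ∀ κ : ℂ, κ.re < μ.re + 1 / 2 → F κ = whittakerIntegral κ μ y

/-- The continuation is unique. -/
theorem IsWhittakerContinuation.unique {μ : ℂ} {y : ℝ} {F G : ℂ → ℂ}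
    (hF : IsWhittakerContinuation μ y F) (hG : IsWhittakerContinuation μ y G) : F = G := by
  have hFa : AnalyticOnNhd ℂ F Set.univ :=
    hF.1.differentiableOn.analyticOnNhd isOpen_univ
  have hGa : AnalyticOnNhd ℂ G Set.univ :=
    hG.1.differentiableOn.analyticOnNhd isOpen_univ
  refine AnalyticOnNhd.eq_of_eventuallyEq (z₀ := μ) hFa hGa ?_
  have hopen : IsOpen {κ : ℂ | κ.re < μ.re + 1 / 2} :=
    isOpen_lt Complex.continuous_re continuous_const
  have hmem : μ ∈ {κ : ℂ | κ.re < μ.re + 1 / 2} := by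
    simp only [Set.mem_ofPred_eq]
    linarith
  filter_upwards [hopen.mem_nhds hmem] with κ hκ
  rw [hF.2 κ hκ, hG.2 κ hκ]

open Classical in
/-- The Whittaker function `W_{κ,μ}(y)` for `y > 0`.  For fixed `μ` and `y > 0` it is an entire
function of `κ`, given by the integral representation for `Re κ < Re μ + 1/2`; for all other `κ` it
is the value of the (unique) entire continuation. -/
def whittakerW (κ μ : ℂ) (y : ℝ) : ℂ :=
  if h : ∃ F : ℂ → ℂ, IsWhittakerContinuation μ y F then h.choose κ else 0

/-! ### The Eisenstein series for `R(N)` -/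

/-- `(ℤ × ℤ)_{N,L} = ⨆_{t > 0} {(m,n) ∈ tℤ × tℤ : gcd(Nm, n) = t}`. -/
def pairsL (N : ℕ) : Set (ℤ × ℤ) :=
  {p | ∃ t : ℕ, 0 < t ∧ (t : ℤ) ∣ p.1 ∧ (t : ℤ) ∣ p.2 ∧ Int.gcd ((N : ℤ) * p.1) p.2 = t}

/-- `(ℤ × ℤ)_{N,R} = ⨆_{t > 0} {(m,n) ∈ tℤ × tℤ : gcd(m, Nn) = t}`. -/
def pairsR (N : ℕ) : Set (ℤ × ℤ) :=
  {p | ∃ t : ℕ, 0 < t ∧ (t : ℤ) ∣ p.1 ∧ (t : ℤ) ∣ p.2 ∧ Int.gcd p.1 ((N : ℤ) * p.2) = t}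

/-- `y^s / (|w|^{2s} w^k)`, where `y = Im z`. -/
def eisTerm (k : ℤ) (z : UpperHalfPlane) (s : ℂ) (w : ℂ) : ℂ :=
  (z.im : ℂ) ^ s / ((‖w‖ : ℂ) ^ (2 * s) * w ^ k)

/-- The summand of `G_{N,k,L}(z,s)`, with `w = √N m z + n`. -/
def eisTermL (N : ℕ) (k : ℤ) (z : UpperHalfPlane) (s : ℂ) (p : pairsL N) : ℂ :=
  eisTerm k z s (((√(N : ℝ) : ℝ) : ℂ) * (p.1.1 : ℂ) * (z : ℂ) + (p.1.2 : ℂ))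

/-- The summand of `G_{N,k,R}(z,s)`, with `w = m z + √N n`. -/
def eisTermR (N : ℕ) (k : ℤ) (z : UpperHalfPlane) (s : ℂ) (p : pairsR N) : ℂ :=
  eisTerm k z s ((p.1.1 : ℂ) * (z : ℂ) + ((√(N : ℝ) : ℝ) : ℂ) * (p.1.2 : ℂ))

/-- `G_{N,k,L}(z,s)`, for `Re s > 1 - k/2`. -/
def eisensteinGL (N : ℕ) (k : ℤ) (z : UpperHalfPlane) (s : ℂ) : ℂ :=
  1 / 2 * ∑' p : pairsL N, eisTermL N k z s p

/-- `G_{N,k,R}(z,s)`, for `Re s > 1 - k/2`. -/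
def eisensteinGR (N : ℕ) (k : ℤ) (z : UpperHalfPlane) (s : ℂ) : ℂ :=
  1 / 2 * ∑' p : pairsR N, eisTermR N k z s p

/-- The non-holomorphic Eisenstein series `G_{N,k}(z,s)` for `R(N)`, for `Re s > 1 - k/2`. -/
def eisensteinG (N : ℕ) (k : ℤ) (z : UpperHalfPlane) (s : ℂ) : ℂ :=
  eisensteinGL N k z s + eisensteinGR N k z s

/-! ### The local factors -/

/-- `ζ_p(s) = (1 - p^{-s})⁻¹`. -/
def localZeta (p : ℕ) (s : ℂ) : ℂ := (1 - (p : ℂ) ^ (-s))⁻¹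

/-- `ζ_p(s; v) = ∑_{n=0}^{v} p^{-ns}`. -/
def truncLocalZeta (p : ℕ) (s : ℂ) (v : ℕ) : ℂ :=
  ∑ n ∈ Finset.range (v + 1), (p : ℂ) ^ (-(n : ℂ) * s)

/-- The function `f_{N,b}(s)` (it depends also on the weight `k`), for `b ≠ 0`. -/
def fFactor (N : ℕ) (k : ℤ) (b : ℤ) (s : ℂ) : ℂ :=
  ((N : ℂ) ^ (-(s - 1) - (k : ℂ) / 2) *
      ∏ p ∈ N.primeFactors,
        ((∑ i ∈ Finset.Icc 1 (padicValInt p b),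
            ((p : ℂ) - 1) * (p : ℂ) ^ ((i : ℂ) - 1 + (i : ℂ) * (2 * s + (k : ℂ) - 2))) -
          (p : ℂ) ^ ((padicValInt p b : ℂ) +
            ((padicValInt p b : ℂ) + 1) * (2 * s + (k : ℂ) - 2))) + 1) /
    ∏ p ∈ N.primeFactors,
      ((localZeta p (-2 * s - (k : ℂ) + 2))⁻¹ *
        truncLocalZeta p (-2 * s - (k : ℂ) + 1) (padicValInt p b))

/-- The completed Eisenstein series `Ĝ_{N,k}(z,s)`; here `f_N = f_{N,1}`. -/
def eisensteinGHat (N : ℕ) (k : ℤ) (z : UpperHalfPlane) (s : ℂ) : ℂ :=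
  ((Real.pi / √(N : ℝ) : ℝ) : ℂ) ^ (-s - (k : ℂ) / 2) *
    Complex.Gamma (s + (k : ℂ) / 2 + ((|k| : ℤ) : ℂ) / 2) * fFactor N k 1 s *
    eisensteinG N k z s

/-- `σ_ν(n) = ∑_{d ∣ n} d^ν`, over the positive divisors `d` of the non-zero integer `n`. -/
def sigmaC (ν : ℂ) (n : ℤ) : ℂ := ∑ d ∈ n.natAbs.divisors, (d : ℂ) ^ ν

/-! ### The terms of the Fourier expansion -/

/-- The constant term (with respect to `x`) of `Ĝ_{N,k}(x+iy,s)`.  Here `completedRiemannZeta` is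
`π^{-s/2} Γ(s/2) ζ(s)`, continued through the zeros of `ζ` at the poles of `Γ(s/2)`. -/
def constTerm (N : ℕ) (k : ℤ) (y : ℝ) (s : ℂ) : ℂ :=
  Complex.Gamma (s + (k : ℂ) / 2 + ((|k| : ℤ) : ℂ) / 2) / Complex.Gamma (s + (k : ℂ) / 2) *
      completedRiemannZeta (2 * s + k) * (y : ℂ) ^ s *
      ((√(N : ℝ) : ℝ) : ℂ) ^ (s + (k : ℂ) / 2) * fFactor N k 1 s +
    (-1 : ℂ) ^ (k / 2) *
      (Complex.Gamma (s + (k : ℂ) / 2) *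
          Complex.Gamma (s + (k : ℂ) / 2 + ((|k| : ℤ) : ℂ) / 2) /
        (Complex.Gamma (s + k) * Complex.Gamma s)) *
      completedRiemannZeta (2 - k - 2 * s) * (y : ℂ) ^ (1 - k - s) * fFactor N k 1 s *
      (((√(N : ℝ) : ℝ) : ℂ) ^ (1 - s - (k : ℂ) / 2) *
          ∏ p ∈ N.primeFactors, (1 - (p : ℂ)⁻¹) / (1 - (p : ℂ) ^ (-2 * s - k)) +
        ((√(N : ℝ) : ℝ) : ℂ) ^ (-1 + s + (k : ℂ) / 2) *
          ∏ p ∈ N.primeFactors, (1 - (p : ℂ) ^ (1 - k - 2 * s)) / (1 - (p : ℂ) ^ (-2 * s - k)))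

/-- The coefficient of `e^{2πinx/√N}` in `Ĝ_{N,k}(x+iy,s)`, for `n ≠ 0`. -/
def fourierCoeffN (N : ℕ) (k : ℤ) (y : ℝ) (s : ℂ) (n : ℤ) : ℂ :=
  (-1 : ℂ) ^ (k / 2) * (y : ℂ) ^ (-(k : ℂ) / 2) *
    (Complex.Gamma (s + (k : ℂ) / 2 + ((|k| : ℤ) : ℂ) / 2) /
      Complex.Gamma (s + (k : ℂ) / 2 + (n.sign : ℂ) * (k : ℂ) / 2)) *
    ((|n| : ℤ) : ℂ) ^ (-s - (k : ℂ) / 2) * sigmaC (2 * s + k - 1) n *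
    whittakerW ((n.sign : ℂ) * (k : ℂ) / 2) (s + ((k : ℂ) - 1) / 2)
      (4 * Real.pi * ((|n| : ℤ) : ℝ) * (y / √(N : ℝ))) *
    fFactor N k n (1 - k - s) * fFactor N k 1 s

end RNEisenstein

end

/-! Write q = 2s + k, w = s + k/2 and φ(u) = |u|^{-2s} u^{-k}; φ is even and homogeneous of degree
-q under positive scaling.

Arithmetic. A nonzero pair lies in `pairsL N` exactly when v_p(n) ≤ v_p(m) for all p ∣ N.
Multiplying the sum by ∏ (1 - p^{-q}) discards the pairs divisible by some p ∣ N and leaves those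
with n prime to N. Inclusion-exclusion over sets T of primes of N, together with homogeneity and
squarefreeness of N, then writes both series as combinations of the sums of φ over ℤ(Dz/√N) + ℤ,
where D = ∏_{p ∈ T} p (`tsum_pairsL`, `tsum_eisPhi_pairsL`, `tsum_eisPhi_pairsR`). A lattice sum is
expanded row by row by Poisson summation, and grouping by the product of row index and frequency
produces σ_{1-q} (`hasSum_latticeSum`). At Dz/√N only frequencies n divisible by D occur, and
σ_{1-q}(n/D)/σ_{1-q}(n) is a product of local ratios. So the sum over T factors over primes
(`hasSum_eisenstein`), and the resulting `localCoeff` is, up to elementary factors, f_{N,n}(1-k-s)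
(`localCoeff_of_ne_zero`).

Analysis. The archimedean factor is the Fourier transform of (y-ix)^{-(w+κ)} (y+ix)^{-(w-κ)} at κ =
±k/2. For κ near 0 it is a Whittaker integral, by the multiplication formula for Fourier transforms.
Since the exponents add up to 2w whatever κ is, the transform is entire in κ; this both yields the
continuation of the Whittaker integral and extends the identity to every κ
(`exists_isWhittakerContinuation`, `whittakerW_div_Gamma`). At frequency zero it is a quotient of
Gamma values, and the duplication formula with the functional equation of ζ gives the second
constant term (`constTerm_eq`). -/

namespace RNEisenstein

open MeasureTheory Set Filter Complex
open scoped Topology FourierTransform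

/-! ### Holomorphic parameter integrals -/

/-- An integral depending holomorphically on a parameter, locally uniformly dominated, is a
holomorphic function of the parameter. -/
theorem differentiableOn_integral_of_dominated {X : Type*} [MeasurableSpace X] {μ : Measure X}
    {F : ℂ → X → ℂ} {U : Set ℂ} (hU : IsOpen U)
    (hmeas : ∀ κ ∈ U, AEStronglyMeasurable (F κ) μ)
    (hdiff : ∀ᵐ x ∂μ, DifferentiableOn ℂ (fun κ => F κ x) U)
    (hdom : ∀ κ₀ ∈ U, ∃ V ∈ 𝓝 κ₀, ∃ bound : X → ℝ, Integrable bound μ ∧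
      ∀ᵐ x ∂μ, ∀ κ ∈ V, ‖F κ x‖ ≤ bound x) :
    DifferentiableOn ℂ (fun κ => ∫ x, F κ x ∂μ) U := by
  intro κ₀ hκ₀
  obtain ⟨V, hV, bound, hint, hle⟩ := hdom κ₀ hκ₀
  obtain ⟨ε, hε, hball⟩ := Metric.mem_nhds_iff.1 (Filter.inter_mem hV (hU.mem_nhds hκ₀))
  have hsub : ∀ κ ∈ Metric.ball κ₀ (ε / 2), Metric.closedBall κ (ε / 4) ⊆ Metric.ball κ₀ ε := by
    intro κ hκ z hz
    rw [Metric.mem_ball] at *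
    rw [Metric.mem_closedBall] at hz
    linarith [dist_triangle z κ κ₀]
  have hmem : ∀ κ ∈ Metric.ball κ₀ (ε / 2), κ ∈ U := fun κ hκ =>
    (hball (hsub κ hκ (Metric.mem_closedBall_self (by positivity)))).2
  have hderiv : ∀ᵐ x ∂μ, ∀ κ ∈ Metric.ball κ₀ (ε / 2),
      HasDerivAt (fun κ => F κ x) (deriv (fun κ => F κ x) κ) κ := by
    filter_upwards [hdiff] with x hx κ hκ
    exact (hx.differentiableAt (hU.mem_nhds (hmem κ hκ))).hasDerivAt
  have hself : κ₀ ∈ Metric.ball κ₀ (ε / 2) := Metric.mem_ball_self (by positivity)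
  have key := hasDerivAt_integral_of_dominated_loc_of_deriv_le (μ := μ) (F := F) (x₀ := κ₀)
    (s := Metric.ball κ₀ (ε / 2)) (bound := fun x => bound x / (ε / 4))
    (F' := fun κ x => deriv (fun κ => F κ x) κ) (Metric.ball_mem_nhds _ (by positivity))
    ?_ ?_ ?_ ?_ (hint.div_const _) hderiv
  · exact key.2.differentiableAt.differentiableWithinAt
  · filter_upwards [hU.mem_nhds hκ₀] with κ hκ using hmeas κ hκ
  · refine hint.mono' (hmeas κ₀ hκ₀) ?_
    filter_upwards [hle] with x hx using hx κ₀ (mem_of_mem_nhds hV)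
  -- The derivative at κ₀ is measurable in x as a pointwise limit of difference quotients. The
  -- increments are nonzero and smaller than ε/2, so they stay where F is measurable.
  · set a : ℕ → ℂ := fun n => ((ε / 2 / (n + 2) : ℝ) : ℂ) with ha
    have ha0 : ∀ n, a n ≠ 0 := fun n => by
      rw [ha]
      exact ofReal_ne_zero.2 (by positivity)
    have hat : Tendsto a atTop (𝓝 0) := by
      have h1 : Tendsto (fun n : ℕ => ε / 2 / ((n : ℝ) + 2)) atTop (𝓝 0) :=
        tendsto_const_nhds.div_atTop
          (tendsto_atTop_add_const_right _ _ tendsto_natCast_atTop_atTop)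
      have h2 := (continuous_ofReal.tendsto 0).comp h1
      simpa using! h2
    have hamem : ∀ n, κ₀ + a n ∈ U := by
      intro n
      refine hmem _ ?_
      rw [Metric.mem_ball, dist_eq_norm, add_sub_cancel_left, ha, norm_real, Real.norm_eq_abs,
        abs_of_pos (by positivity)]
      rw [div_lt_iff₀ (by positivity)]
      have : (0 : ℝ) ≤ n := n.cast_nonneg
      nlinarith
    refine aestronglyMeasurable_of_tendsto_ae atTop
      (f := fun n x => (a n)⁻¹ * (F (κ₀ + a n) x - F κ₀ x)) (fun n => ?_) ?_
    · exact ((hmeas _ (hamem n)).sub (hmeas _ hκ₀)).const_mul _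
    · filter_upwards [hderiv] with x hx
      have := (hasDerivAt_iff_tendsto_slope_zero.1 (hx κ₀ hself)).comp
        (tendsto_nhdsWithin_iff.2 ⟨hat, Eventually.of_forall ha0⟩)
      exact this
  -- Cauchy's estimate on the circle of radius ε/4 around κ, which still lies in the ball where the
  -- bound holds.
  · filter_upwards [hle, hdiff] with x hx hdx κ hκ
    refine norm_deriv_le_of_forall_mem_sphere_norm_le (by positivity) ?_ ?_
    · refine (hdx.mono ?_).diffContOnCl (𝕜 := ℂ)
      rw [closure_ball _ (by positivity)]
      exact fun z hz => (hball (hsub κ hκ hz)).2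
    · exact fun z hz => hx z (hball (hsub κ hκ (Metric.sphere_subset_closedBall hz))).1

/-! ### The Gamma integral with complex rate -/

theorem norm_cpow_mul_exp_neg {a r : ℂ} {t : ℝ} (ht : 0 < t) :
    ‖(t : ℂ) ^ (a - 1) * cexp (-(r * t))‖ = t ^ (a.re - 1) * Real.exp (-(r.re * t)) := by
  rw [norm_mul, norm_cpow_eq_rpow_re_of_pos ht, norm_exp]
  simp

theorem integrableOn_rpow_mul_exp {a r : ℝ} (ha : 0 < a) (hr : 0 < r) :
    IntegrableOn (fun t : ℝ => t ^ (a - 1) * Real.exp (-(r * t))) (Ioi 0) := by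
  have h := integrableOn_rpow_mul_exp_neg_mul_rpow (p := 1) (s := a - 1) (b := r) (by linarith)
    zero_lt_one hr
  simpa using h

theorem aestronglyMeasurable_cpow_mul_exp (a r : ℂ) :
    AEStronglyMeasurable (fun t : ℝ => (t : ℂ) ^ (a - 1) * cexp (-(r * t)))
      (volume.restrict (Ioi 0)) := by
  refine ContinuousOn.aestronglyMeasurable (fun t ht => ?_) measurableSet_Ioi
  refine ContinuousAt.continuousWithinAt ?_
  refine ContinuousAt.mul ?_ (by fun_prop)
  exact continuous_ofReal.continuousAt.cpow continuousAt_const (Or.inl (by simpa using ht))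

theorem integrableOn_cpow_mul_exp {a r : ℂ} (ha : 0 < a.re) (hr : 0 < r.re) :
    IntegrableOn (fun t : ℝ => (t : ℂ) ^ (a - 1) * cexp (-(r * t))) (Ioi 0) := by
  refine (integrableOn_rpow_mul_exp ha hr).mono' (aestronglyMeasurable_cpow_mul_exp a r) ?_
  filter_upwards [ae_restrict_mem measurableSet_Ioi] with t ht
  exact (norm_cpow_mul_exp_neg ht).le

/-- Both sides are holomorphic in r on the right half plane, and they agree at the real points 1 +
1/(n+1), which accumulate at 1. -/
theorem integral_cpow_mul_exp_neg_complex_mul {a r : ℂ} (ha : 0 < a.re) (hr : 0 < r.re) :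
    ∫ t in Ioi (0 : ℝ), (t : ℂ) ^ (a - 1) * cexp (-(r * t)) = r ^ (-a) * Gamma a := by
  set U : Set ℂ := {r | 0 < r.re}
  have hU : IsOpen U := isOpen_lt continuous_const continuous_re
  have hdiff : DifferentiableOn ℂ
      (fun r => ∫ t in Ioi (0 : ℝ), (t : ℂ) ^ (a - 1) * cexp (-(r * t))) U := by
    refine differentiableOn_integral_of_dominated hU
      (fun r _ => aestronglyMeasurable_cpow_mul_exp a r) (ae_of_all _ fun t => by fun_prop) ?_
    intro r₀ hr₀
    have hr₀' : 0 < r₀.re := hr₀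
    refine ⟨{r | r₀.re / 2 < r.re},
      (isOpen_lt continuous_const continuous_re).mem_nhds (by simp [hr₀']), _,
      integrableOn_rpow_mul_exp ha (r := r₀.re / 2) (by linarith), ?_⟩
    filter_upwards [ae_restrict_mem measurableSet_Ioi] with t ht r hr'
    rw [norm_cpow_mul_exp_neg ht]
    have ht' : 0 < t := ht
    have hr'' : r₀.re / 2 < r.re := hr'
    gcongr
  have hdiff2 : DifferentiableOn ℂ (fun r : ℂ => r ^ (-a) * Gamma a) U := fun r hr' =>
    ((differentiableAt_id.cpow_const (Or.inl hr')).mul_const _).differentiableWithinAt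
  refine (hdiff.analyticOnNhd hU).eqOn_of_preconnected_of_frequently_eq
    (hdiff2.analyticOnNhd hU) (convex_halfSpace_re_gt 0).isPreconnected (z₀ := 1) (by simp [U])
    ?_ hr
  have h1 : Tendsto (fun n : ℕ => (1 : ℂ) + ((1 / ((n : ℝ) + 1) : ℝ) : ℂ)) atTop (𝓝[≠] 1) := by
    refine tendsto_nhdsWithin_iff.2 ⟨?_, Eventually.of_forall fun n => ?_⟩
    · have := (continuous_ofReal.tendsto 0).comp
        (tendsto_one_div_add_atTop_nhds_zero_nat (𝕜 := ℝ))
      simpa using! (this.const_add (1 : ℂ))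
    · simp only [mem_compl_iff, mem_singleton_iff, add_eq_left]
      exact ofReal_ne_zero.2 (by positivity)
  refine h1.frequently (Eventually.frequently (Eventually.of_forall fun n => ?_))
  have hpos : (0 : ℝ) < 1 + 1 / ((n : ℝ) + 1) := by positivity
  have := integral_cpow_mul_exp_neg_mul_Ioi ha hpos
  simp only [ofReal_add, ofReal_one] at this
  rw [this, one_div, inv_cpow, cpow_neg]
  rw [← ofReal_one, ← ofReal_add, arg_ofReal_of_nonneg hpos.le]
  exact Real.pi_pos.ne

/-! ### The kernel `(y - ix)^{-α} (y + ix)^{-β}` and its Fourier transform -/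

/-- The function `x ↦ (y - ix)^{-α} (y + ix)^{-β}`. -/
noncomputable def eisKer (α β : ℂ) (y x : ℝ) : ℂ :=
  ((y : ℂ) - x * I) ^ (-α) * ((y : ℂ) + x * I) ^ (-β)

theorem sub_mul_I_mem_slitPlane {y : ℝ} (hy : 0 < y) (x : ℝ) : (y : ℂ) - x * I ∈ slitPlane :=
  Or.inl (by simpa using hy)

theorem add_mul_I_mem_slitPlane {y : ℝ} (hy : 0 < y) (x : ℝ) : (y : ℂ) + x * I ∈ slitPlane :=
  Or.inl (by simpa using hy)

theorem norm_sub_mul_I (y x : ℝ) : ‖(y : ℂ) - x * I‖ = ‖(y : ℂ) + x * I‖ := by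
  rw [← norm_conj ((y : ℂ) + x * I)]
  simp [sub_eq_add_neg]

theorem norm_cpow_neg_le {z : ℂ} (hz : z ≠ 0) (a : ℂ) :
    ‖z ^ (-a)‖ ≤ Real.exp (Real.pi * |a.im|) * ‖z‖ ^ (-a.re) := by
  rw [norm_cpow_of_ne_zero hz, div_eq_mul_inv, ← Real.exp_neg, mul_comm]
  refine mul_le_mul_of_nonneg_right (Real.exp_le_exp.2 ?_) (by positivity)
  calc -(z.arg * (-a).im) ≤ |z.arg * a.im| := by
        rw [neg_im, mul_neg, neg_neg]; exact le_abs_self _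
    _ = |z.arg| * |a.im| := abs_mul _ _
    _ ≤ Real.pi * |a.im| := by
        gcongr
        exact abs_arg_le_pi z

theorem norm_eisKer_le (α β : ℂ) {y : ℝ} (hy : 0 < y) (x : ℝ) :
    ‖eisKer α β y x‖ ≤ Real.exp (Real.pi * (|α.im| + |β.im|)) *
      ‖(y : ℂ) + x * I‖ ^ (-(α + β).re) := by
  have h0 := slitPlane_ne_zero (add_mul_I_mem_slitPlane hy x)
  have h1 := norm_cpow_neg_le (slitPlane_ne_zero (sub_mul_I_mem_slitPlane hy x)) α
  have h2 := norm_cpow_neg_le h0 β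
  rw [norm_sub_mul_I] at h1
  rw [eisKer, norm_mul]
  refine (mul_le_mul h1 h2 (norm_nonneg _) (by positivity)).trans (le_of_eq ?_)
  rw [add_re, neg_add, Real.rpow_add (norm_pos_iff.2 h0), mul_add, Real.exp_add]
  ring

/-- The average of the bounds |y + ix| ≥ y and |y + ix| ≥ |x|, weakened by `min y 1`. -/
theorem le_norm_add_mul_I (y x : ℝ) :
    min y 1 / 2 * (1 + |x|) ≤ ‖(y : ℂ) + x * I‖ := by
  have h1 : |y| ≤ ‖(y : ℂ) + x * I‖ := by simpa using abs_re_le_norm ((y : ℂ) + x * I)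
  have h2 : |x| ≤ ‖(y : ℂ) + x * I‖ := by simpa using abs_im_le_norm ((y : ℂ) + x * I)
  have h3 := le_abs_self y
  have h4 : min y 1 * |x| ≤ 1 * |x| := by gcongr; exact min_le_right _ _
  have h5 := min_le_left y 1
  linarith

/-- A bound for the kernel by a power of `1 + |x|`. -/
theorem norm_eisKer_le_rpow (α β : ℂ) {y : ℝ} (hy : 0 < y) (hre : 0 ≤ (α + β).re) (x : ℝ) :
    ‖eisKer α β y x‖ ≤ Real.exp (Real.pi * (|α.im| + |β.im|)) *
      (min y 1 / 2) ^ (-(α + β).re) * (1 + |x|) ^ (-(α + β).re) := by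
  refine (norm_eisKer_le α β hy x).trans ?_
  have hm : 0 < min y 1 / 2 := by positivity
  have hx : 0 < 1 + |x| := by positivity
  rw [mul_assoc, ← Real.mul_rpow hm.le hx.le]
  gcongr ?_ * ?_
  exact Real.rpow_le_rpow_of_nonpos (by positivity) (le_norm_add_mul_I y x) (by linarith)

theorem continuous_eisKer (α β : ℂ) {y : ℝ} (hy : 0 < y) : Continuous (eisKer α β y) := by
  unfold eisKer
  refine Continuous.mul ?_ ?_
  · exact Continuous.cpow (by fun_prop) continuous_const fun x => sub_mul_I_mem_slitPlane hy x
  · exact Continuous.cpow (by fun_prop) continuous_const fun x => add_mul_I_mem_slitPlane hy x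

theorem integrable_one_add_abs_rpow {c : ℝ} (hc : 1 < c) :
    Integrable fun x : ℝ => (1 + |x|) ^ (-c) := by
  simpa using integrable_one_add_norm (E := ℝ) (μ := volume) (r := c) (by simpa using hc)

theorem integrable_eisKer {α β : ℂ} {y : ℝ} (hy : 0 < y) (hre : 1 < (α + β).re) :
    Integrable (eisKer α β y) :=
  ((integrable_one_add_abs_rpow hre).const_mul _).mono'
    (continuous_eisKer α β hy).aestronglyMeasurable
    (ae_of_all _ (norm_eisKer_le_rpow α β hy (by linarith)))

theorem hasDerivAt_eisKer (α β : ℂ) {y : ℝ} (hy : 0 < y) (x : ℝ) :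
    HasDerivAt (eisKer α β y)
      (I * α * eisKer (α + 1) β y x - I * β * eisKer α (β + 1) y x) x := by
  have hx := hasDerivAt_id (x : ℂ)
  have h1 : HasDerivAt (fun x : ℂ => (y : ℂ) - x * I) (-I) x := by
    simpa using (hx.mul_const I).const_sub (y : ℂ)
  have h2 : HasDerivAt (fun x : ℂ => (y : ℂ) + x * I) I x := by
    simpa using (hx.mul_const I).const_add (y : ℂ)
  have h3 := ((h1.cpow_const (c := -α) (sub_mul_I_mem_slitPlane hy x)).mul
    (h2.cpow_const (c := -β) (add_mul_I_mem_slitPlane hy x))).comp_ofReal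
  refine h3.congr_deriv ?_
  simp only [eisKer]
  rw [show -(α + 1) = -α - 1 by ring, show -(β + 1) = -β - 1 by ring]
  ring

/-- Differentiation becomes multiplication by 2πih. The derivative is a combination of kernels with
one exponent raised by 1, so a power of h is gained without leaving the class Re(α + β) > 1. -/
theorem fourier_eisKer_mul {α β : ℂ} {y : ℝ} (hy : 0 < y) (hre : 1 < (α + β).re) (h : ℝ) :
    2 * Real.pi * h * 𝓕 (eisKer α β y) h =
      α * 𝓕 (eisKer (α + 1) β y) h - β * 𝓕 (eisKer α (β + 1) y) h := by
  have hd : deriv (eisKer α β y) =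
      fun x => I * α * eisKer (α + 1) β y x - I * β * eisKer α (β + 1) y x :=
    funext fun x => (hasDerivAt_eisKer α β hy x).deriv
  have hi1 : Integrable (eisKer (α + 1) β y) := integrable_eisKer hy (by simp at *; linarith)
  have hi2 : Integrable (eisKer α (β + 1) y) := integrable_eisKer hy (by simp at *; linarith)
  have key := congrFun (Real.fourier_deriv (integrable_eisKer hy hre)
    (fun x => (hasDerivAt_eisKer α β hy x).differentiableAt)
    (by rw [hd]; exact (hi1.const_mul _).sub (hi2.const_mul _))) h
  have hlin : 𝓕 (deriv (eisKer α β y)) h =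
      I * α * 𝓕 (eisKer (α + 1) β y) h - I * β * 𝓕 (eisKer α (β + 1) y) h := by
    rw [hd]
    simp only [Real.fourier_real_eq_integral_exp_smul, smul_eq_mul]
    have he : ∀ {f : ℝ → ℂ}, Integrable f →
        Integrable fun v : ℝ => cexp (↑(-2 * Real.pi * v * h) * I) * f v := fun hf =>
      hf.bdd_mul (by fun_prop) (ae_of_all _ fun v => (norm_exp_ofReal_mul_I _).le)
    rw [← integral_const_mul, ← integral_const_mul, ← integral_sub ((he hi1).const_mul _)
      ((he hi2).const_mul _)]
    congr 1
    funext v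
    ring
  rw [hlin] at key
  simp only [smul_eq_mul] at key
  have hI : I * (2 * Real.pi * h * 𝓕 (eisKer α β y) h) =
      I * (α * 𝓕 (eisKer (α + 1) β y) h - β * 𝓕 (eisKer α (β + 1) y) h) := by
    linear_combination -key
  exact mul_left_cancel₀ I_ne_zero hI

theorem norm_fourier_eisKer_le (α β : ℂ) (y h : ℝ) :
    ‖𝓕 (eisKer α β y) h‖ ≤ ∫ x, ‖eisKer α β y x‖ := by
  rw [Real.fourier_real_eq_integral_exp_smul]
  refine (norm_integral_le_integral_norm _).trans (le_of_eq ?_)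
  congr 1
  funext v
  rw [norm_smul, norm_exp_ofReal_mul_I, one_mul]

/-- Rapid decay, by iterating `fourier_eisKer_mul`. The exponents are quantified inside the
induction because each step shifts them. -/
theorem exists_norm_fourier_eisKer_mul_pow_le (j : ℕ) {y : ℝ} (hy : 0 < y) :
    ∀ {α β : ℂ}, 1 < (α + β).re → ∃ C : ℝ, ∀ h : ℝ, |h| ^ j * ‖𝓕 (eisKer α β y) h‖ ≤ C := by
  induction j with
  | zero => exact fun {α β} _ => ⟨_, fun h => by
      simpa using norm_fourier_eisKer_le α β y h⟩
  | succ j ih =>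
    intro α β hre
    obtain ⟨C₁, h₁⟩ := ih (α := α + 1) (β := β) (by simp at *; linarith)
    obtain ⟨C₂, h₂⟩ := ih (α := α) (β := β + 1) (by simp at *; linarith)
    refine ⟨‖α‖ * C₁ + ‖β‖ * C₂, fun h => ?_⟩
    have key := congrArg norm (fourier_eisKer_mul hy hre h)
    have hpi : (1 : ℝ) ≤ 2 * Real.pi := by linarith [Real.pi_gt_three]
    have hn : ‖(2 * Real.pi * h : ℂ)‖ = 2 * Real.pi * |h| := by
      simp [abs_of_pos Real.pi_pos]
    rw [norm_mul, hn] at key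
    have h3 := norm_sub_le (α * 𝓕 (eisKer (α + 1) β y) h) (β * 𝓕 (eisKer α (β + 1) y) h)
    rw [norm_mul, norm_mul] at h3
    calc |h| ^ (j + 1) * ‖𝓕 (eisKer α β y) h‖
        ≤ |h| ^ j * (2 * Real.pi * |h| * ‖𝓕 (eisKer α β y) h‖) := by
          rw [pow_succ, mul_assoc]
          gcongr
          nlinarith [abs_nonneg h]
      _ ≤ |h| ^ j * (‖α‖ * ‖𝓕 (eisKer (α + 1) β y) h‖ + ‖β‖ * ‖𝓕 (eisKer α (β + 1) y) h‖) := by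
          rw [key]; gcongr
      _ = ‖α‖ * (|h| ^ j * ‖𝓕 (eisKer (α + 1) β y) h‖) +
            ‖β‖ * (|h| ^ j * ‖𝓕 (eisKer α (β + 1) y) h‖) := by ring
      _ ≤ ‖α‖ * C₁ + ‖β‖ * C₂ := by gcongr; exacts [h₁ h, h₂ h]

theorem ofReal_mul_cpow {c : ℝ} (hc : 0 < c) (z a : ℂ) :
    ((c : ℂ) * z) ^ a = (c : ℂ) ^ a * z ^ a := by
  have hc' : (c : ℂ) ≠ 0 := ofReal_ne_zero.2 hc.ne'
  rcases eq_or_ne z 0 with rfl | hz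
  · rcases eq_or_ne a 0 with rfl | ha
    · simp
    · simp [zero_cpow ha]
  · rw [cpow_def_of_ne_zero (mul_ne_zero hc' hz), cpow_def_of_ne_zero hc',
      cpow_def_of_ne_zero hz, log_ofReal_mul hc hz, ← Complex.exp_add, ofReal_log hc.le]
    ring_nf

theorem eisKer_mul (α β : ℂ) {c y : ℝ} (hc : 0 < c) (x : ℝ) :
    eisKer α β (c * y) (c * x) = (c : ℂ) ^ (-α - β) * eisKer α β y x := by
  have h1 : ((c * y : ℝ) : ℂ) - (c * x : ℝ) * I = c * ((y : ℂ) - x * I) := by push_cast; ring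
  have h2 : ((c * y : ℝ) : ℂ) + (c * x : ℝ) * I = c * ((y : ℂ) + x * I) := by push_cast; ring
  have hc' : (c : ℂ) ≠ 0 := ofReal_ne_zero.2 hc.ne'
  rw [eisKer, eisKer, h1, h2, ofReal_mul_cpow hc, ofReal_mul_cpow hc,
    sub_eq_add_neg (-α) β, cpow_add _ _ hc']
  ring

/-- The kernel is homogeneous of degree -(α + β) in (y, x); substituting cx for x adds one more
factor c. -/
theorem fourier_eisKer_mul_left (α β : ℂ) {c : ℝ} (hc : 0 < c) (y h : ℝ) :
    𝓕 (eisKer α β (c * y)) h = (c : ℂ) ^ (1 - α - β) * 𝓕 (eisKer α β y) (c * h) := by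
  have hc' : (c : ℂ) ≠ 0 := ofReal_ne_zero.2 hc.ne'
  simp only [Real.fourier_real_eq_integral_exp_smul, smul_eq_mul]
  have := Measure.integral_comp_mul_left
    (fun x : ℝ => cexp (↑(-2 * Real.pi * x * h) * I) * eisKer α β (c * y) x) c
  rw [abs_inv, abs_of_pos hc, real_smul, ofReal_inv, eq_inv_mul_iff_mul_eq₀ hc'] at this
  rw [← this, show 1 - α - β = 1 + (-α - β) by ring, cpow_add _ _ hc', cpow_one, mul_assoc,
    ← integral_const_mul ((c : ℂ) ^ (-α - β))]
  congr 2
  funext x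
  rw [eisKer_mul α β hc]
  push_cast
  ring_nf

/-- The substitution x ↦ -x exchanges the two factors of the kernel. This is how negative
frequencies reduce to positive ones. -/
theorem fourier_eisKer_neg (α β : ℂ) (y h : ℝ) :
    𝓕 (eisKer α β y) (-h) = 𝓕 (eisKer β α y) h := by
  simp only [Real.fourier_real_eq_integral_exp_smul, smul_eq_mul]
  rw [← integral_neg_eq_self]
  congr 1
  funext x
  simp only [eisKer]
  push_cast
  ring_nf

/-! ### Closed forms for the Fourier transform of the kernel -/

/-- The density `t^{a-1} e^{-2πyt}` on `t > 0`, extended by zero. -/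
noncomputable def gammaDensity (a : ℂ) (y : ℝ) : ℝ → ℂ :=
  indicator (Ioi 0) fun t : ℝ => (t : ℂ) ^ (a - 1) * cexp (-((2 * Real.pi * y : ℝ) * t))

theorem integrable_gammaDensity {a : ℂ} {y : ℝ} (ha : 0 < a.re) (hy : 0 < y) :
    Integrable (gammaDensity a y) := by
  rw [gammaDensity, integrable_indicator_iff measurableSet_Ioi]
  exact integrableOn_cpow_mul_exp ha (by rw [ofReal_re]; positivity)

/-- The Gamma integral with complex rate 2π(y + ix). -/
theorem fourier_gammaDensity {a : ℂ} {y : ℝ} (ha : 0 < a.re) (hy : 0 < y) (x : ℝ) :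
    𝓕 (gammaDensity a y) x =
      ((2 * Real.pi : ℝ) : ℂ) ^ (-a) * Gamma a * ((y : ℂ) + x * I) ^ (-a) := by
  have hpi : 0 < 2 * Real.pi := by positivity
  rw [Real.fourier_real_eq_integral_exp_smul]
  have hr : 0 < (((2 * Real.pi : ℝ) : ℂ) * ((y : ℂ) + x * I)).re := by
    rw [re_ofReal_mul]
    simpa using mul_pos hpi hy
  have h := integral_cpow_mul_exp_neg_complex_mul ha hr
  rw [ofReal_mul_cpow hpi] at h
  rw [mul_right_comm, ← h, ← integral_indicator measurableSet_Ioi]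
  congr 1
  funext t
  by_cases ht : t ∈ Ioi (0 : ℝ)
  · rw [gammaDensity, indicator_of_mem ht, indicator_of_mem ht, smul_eq_mul, mul_left_comm,
      ← Complex.exp_add]
    congr 2
    push_cast
    ring
  · rw [gammaDensity, indicator_of_notMem ht, indicator_of_notMem ht, smul_zero]

theorem continuous_gammaDensity {a : ℂ} (y : ℝ) (ha : 1 < a.re) :
    Continuous (gammaDensity a y) := by
  have hre : 0 < (a - 1).re := by simpa using ha
  have h : gammaDensity a y =
      fun t : ℝ => ((max t 0 : ℝ) : ℂ) ^ (a - 1) * cexp (-((2 * Real.pi * y : ℝ) * t)) := by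
    funext t
    by_cases ht : t ∈ Ioi (0 : ℝ)
    · rw [gammaDensity, indicator_of_mem ht, max_eq_left (le_of_lt ht)]
    · rw [gammaDensity, indicator_of_notMem ht, max_eq_right (not_lt.1 ht), ofReal_zero,
        zero_cpow (fun h => by simp [h] at hre), zero_mul]
  rw [h]
  exact ((continuous_ofReal_cpow_const hre).comp (by fun_prop)).mul (by fun_prop)

theorem eisKer_zero_right (a : ℂ) (y : ℝ) :
    eisKer a 0 y = fun x : ℝ => ((y : ℂ) - x * I) ^ (-a) := by
  funext x
  simp [eisKer]

/-- Fourier inversion for `gammaDensity`, whose transform is a multiple of the reflected kernel. The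
condition Re a > 1 makes the density continuous at 0 and its transform integrable. -/
theorem fourier_eisKer_zero_right {a : ℂ} {y : ℝ} (ha : 1 < a.re) (hy : 0 < y) {h : ℝ}
    (hh : 0 ≤ h) :
    ((2 * Real.pi : ℝ) : ℂ) ^ (-a) * Gamma a * 𝓕 (eisKer a 0 y) h =
      (h : ℂ) ^ (a - 1) * cexp (-((2 * Real.pi * y : ℝ) * h)) := by
  have ha0 : 0 < a.re := by linarith
  have hF : (fun x => 𝓕 (gammaDensity a y) (-x)) =
      fun x => ((2 * Real.pi : ℝ) : ℂ) ^ (-a) * Gamma a * eisKer a 0 y x := by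
    funext x
    rw [fourier_gammaDensity ha0 hy, eisKer_zero_right]
    push_cast
    ring_nf
  have hint : Integrable (𝓕 (gammaDensity a y)) := by
    have h1 : Integrable fun x => 𝓕 (gammaDensity a y) (-x) := by
      rw [hF]
      exact (integrable_eisKer hy (by simpa using ha)).const_mul _
    simpa using h1.comp_neg
  have key := congrFun ((continuous_gammaDensity y ha).fourierInv_fourier_eq
    (integrable_gammaDensity ha0 hy) hint) h
  rw [Real.fourierInv_eq_fourier_comp_neg, hF] at key
  have h2 : 𝓕 (fun x => ((2 * Real.pi : ℝ) : ℂ) ^ (-a) * Gamma a * eisKer a 0 y x) h =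
      ((2 * Real.pi : ℝ) : ℂ) ^ (-a) * Gamma a * 𝓕 (eisKer a 0 y) h := by
    simp only [Real.fourier_real_eq_integral_exp_smul, smul_eq_mul]
    rw [← integral_const_mul]
    congr 1
    funext v
    ring
  rw [← h2, key, gammaDensity]
  -- At h = 0 the density vanishes because 0 is not in its support, and 0^{a-1} = 0 because a ≠ 1.
  rcases hh.eq_or_lt with rfl | hpos
  · rw [indicator_of_notMem (by simp), ofReal_zero, zero_cpow, zero_mul]
    intro h
    have := congrArg re h
    simp at this
    linarith
  · rw [indicator_of_mem (by exact hpos)]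

/-- The factor (y+ix)^{-β} is itself, up to a constant, the transform of a Gamma density. The
formula ∫ 𝓕f · g = ∫ f · 𝓕g moves the transform onto the modulated factor (y-ix)^{-α}; modulation by
h shifts its transform to t + h. -/
theorem fourier_eisKer_eq_integral {α β : ℂ} {y : ℝ} (hα : 1 < α.re) (hβ : 0 < β.re)
    (hy : 0 < y) {h : ℝ} (hh : 0 ≤ h) :
    Gamma α * Gamma β * 𝓕 (eisKer α β y) h = ((2 * Real.pi : ℝ) : ℂ) ^ (α + β) *
      (cexp (-((2 * Real.pi * y : ℝ) * h)) *
      ∫ t in Ioi (0 : ℝ), (t : ℂ) ^ (β - 1) * ((t : ℂ) + h) ^ (α - 1) *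
        cexp (-((4 * Real.pi * y : ℝ) * t))) := by
  have hpi : ((2 * Real.pi : ℝ) : ℂ) ≠ 0 := ofReal_ne_zero.2 (by positivity)
  set G : ℝ → ℂ := fun x => cexp (↑(-2 * Real.pi * x * h) * I) * eisKer α 0 y x with hG
  have hGint : Integrable G :=
    (integrable_eisKer (α := α) (β := 0) hy (by simpa using hα)).bdd_mul (by fun_prop)
      (ae_of_all _ fun v => (norm_exp_ofReal_mul_I _).le)
  have hFG : ∀ t : ℝ, 𝓕 G t = 𝓕 (eisKer α 0 y) (t + h) := fun t => by
    simp only [Real.fourier_real_eq_integral_exp_smul, smul_eq_mul, hG]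
    congr 1
    funext v
    rw [← mul_assoc, ← Complex.exp_add]
    congr 2
    push_cast
    ring
  have flip : ∫ x, 𝓕 (gammaDensity β y) x * G x = ∫ t, gammaDensity β y t * 𝓕 G t := by
    have := VectorFourier.integral_fourierIntegral_smul_eq_flip (L := innerₗ ℝ)
      (μ := volume) (ν := volume) (f := gammaDensity β y) (g := G) Real.continuous_fourierChar
      (by exact continuous_inner) (integrable_gammaDensity hβ hy) hGint
    rw [flip_innerₗ] at this
    exact this
  have hleft : ∫ x, 𝓕 (gammaDensity β y) x * G x =
      ((2 * Real.pi : ℝ) : ℂ) ^ (-β) * Gamma β * 𝓕 (eisKer α β y) h := by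
    rw [Real.fourier_real_eq_integral_exp_smul, ← integral_const_mul]
    congr 1
    funext x
    rw [fourier_gammaDensity hβ hy, hG, eisKer_zero_right, eisKer, smul_eq_mul]
    ring
  have hright : ((2 * Real.pi : ℝ) : ℂ) ^ (-α) * Gamma α * ∫ t, gammaDensity β y t * 𝓕 G t =
      cexp (-((2 * Real.pi * y : ℝ) * h)) *
      ∫ t in Ioi (0 : ℝ), (t : ℂ) ^ (β - 1) * ((t : ℂ) + h) ^ (α - 1) *
        cexp (-((4 * Real.pi * y : ℝ) * t)) := by
    rw [← integral_const_mul, ← integral_const_mul, ← integral_indicator measurableSet_Ioi]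
    congr 1
    funext t
    by_cases ht : t ∈ Ioi (0 : ℝ)
    · have ht' : 0 < t := ht
      rw [gammaDensity, indicator_of_mem ht, indicator_of_mem ht, hFG, mul_left_comm,
        fourier_eisKer_zero_right hα hy (by linarith)]
      have he : cexp (-((4 * Real.pi * y : ℝ) * t)) * cexp (-((2 * Real.pi * y : ℝ) * h)) =
          cexp (-((2 * Real.pi * y : ℝ) * t)) *
            cexp (-((2 * Real.pi * y : ℝ) * ((t + h : ℝ) : ℂ))) := by
        rw [← Complex.exp_add, ← Complex.exp_add]
        congr 1
        push_cast
        ring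
      rw [ofReal_add] at he ⊢
      linear_combination (-(t : ℂ) ^ (β - 1) * ((t : ℂ) + h) ^ (α - 1)) * he
    · rw [gammaDensity, indicator_of_notMem ht, indicator_of_notMem ht, zero_mul, mul_zero]
  rw [← hright, ← flip, hleft, cpow_add _ _ hpi, cpow_neg, cpow_neg]
  have h1 : ((2 * Real.pi : ℝ) : ℂ) ^ α ≠ 0 := by simp [cpow_eq_zero_iff]
  have h2 : ((2 * Real.pi : ℝ) : ℂ) ^ β ≠ 0 := by simp [cpow_eq_zero_iff]
  field_simp

/-- The Fourier transform at zero. -/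
theorem fourier_eisKer_zero_of_re {α β : ℂ} {y : ℝ} (hα : 1 < α.re) (hβ : 0 < β.re)
    (hy : 0 < y) :
    Gamma α * Gamma β * 𝓕 (eisKer α β y) 0 =
      ((2 * Real.pi : ℝ) : ℂ) ^ (α + β) *
        (((4 * Real.pi * y : ℝ) : ℂ) ^ (1 - (α + β)) * Gamma (α + β - 1)) := by
  rw [fourier_eisKer_eq_integral hα hβ hy le_rfl]
  have h := integral_cpow_mul_exp_neg_complex_mul (a := α + β - 1)
    (r := ((4 * Real.pi * y : ℝ) : ℂ)) (by simp; linarith) (by rw [ofReal_re]; positivity)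
  rw [show 1 - (α + β) = -(α + β - 1) by ring, ← h]
  simp only [ofReal_zero, mul_zero, neg_zero, Complex.exp_zero, one_mul, add_zero]
  congr 1
  refine setIntegral_congr_fun measurableSet_Ioi fun t ht => ?_
  have ht' : (t : ℂ) ≠ 0 := ofReal_ne_zero.2 (ne_of_gt ht)
  rw [← cpow_add _ _ ht']
  ring_nf

/-- The Fourier transform at a positive frequency, in terms of the Whittaker integral. -/
theorem fourier_eisKer_eq_whittakerIntegral {w κ : ℂ} {y : ℝ} (hα : 1 < (w + κ).re)
    (hβ : 0 < (w - κ).re) (hy : 0 < y) {h : ℝ} (hh : 0 < h) :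
    whittakerIntegral κ (w - 1 / 2) (4 * Real.pi * h * y) =
      (h : ℂ) ^ (1 - w) * (y : ℂ) ^ w * (Real.pi : ℂ) ^ (-w) * Gamma (w + κ) *
        𝓕 (eisKer (w + κ) (w - κ) y) h := by
  have hΓ : Gamma (w - κ) ≠ 0 := Gamma_ne_zero_of_re_pos hβ
  have hpi : (Real.pi : ℂ) ≠ 0 := ofReal_ne_zero.2 Real.pi_ne_zero
  have hc : 0 < 4 * Real.pi * y := by positivity
  have hc' : ((4 * Real.pi * y : ℝ) : ℂ) ≠ 0 := ofReal_ne_zero.2 hc.ne'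
  have hY : 4 * Real.pi * h * y = (4 * Real.pi * y) * h := by ring
  have key := fourier_eisKer_eq_integral hα hβ hy hh.le
  -- Substitute u = 4πyt, so that u + 4πhy = 4πy(t + h).
  have hsub := integral_comp_mul_left_Ioi (fun u : ℝ => cexp (-(u : ℂ)) *
    (u : ℂ) ^ (w - κ - 1) * ((u : ℂ) + ((4 * Real.pi * y) * h : ℝ)) ^ (w + κ - 1)) 0 hc
  rw [mul_zero, real_smul, ofReal_inv, eq_inv_mul_iff_mul_eq₀ hc'] at hsub
  have hint : ∫ x in Ioi (0 : ℝ), cexp (-((4 * Real.pi * y * x : ℝ) : ℂ)) *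
      ((4 * Real.pi * y * x : ℝ) : ℂ) ^ (w - κ - 1) *
      (((4 * Real.pi * y * x : ℝ) : ℂ) + ((4 * Real.pi * y) * h : ℝ)) ^ (w + κ - 1) =
      ((4 * Real.pi * y : ℝ) : ℂ) ^ (2 * w - 2) *
      ∫ t in Ioi (0 : ℝ), (t : ℂ) ^ (w - κ - 1) * ((t : ℂ) + h) ^ (w + κ - 1) *
        cexp (-((4 * Real.pi * y : ℝ) * t)) := by
    rw [← integral_const_mul]
    congr 1
    funext t
    rw [← ofReal_add, ← mul_add, ofReal_mul, ofReal_mul (4 * Real.pi * y) (t + h),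
      ofReal_mul_cpow hc, ofReal_mul_cpow hc, show 2 * w - 2 = (w - κ - 1) + (w + κ - 1) by ring,
      cpow_add _ _ hc', ofReal_add]
    ring
  rw [hint] at hsub
  rw [whittakerIntegral, hY, show 1 / 2 - (w - 1 / 2) = 1 - w by ring,
    show w - 1 / 2 + 1 / 2 - κ = w - κ by ring, show w - 1 / 2 - κ - 1 / 2 = w - κ - 1 by ring,
    show w - 1 / 2 + κ - 1 / 2 = w + κ - 1 by ring, ← hsub]
  rw [div_mul_eq_mul_div, div_eq_iff hΓ]
  have he : cexp (-((4 * Real.pi * y * h : ℝ) : ℂ) / 2) =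
      cexp (-((2 * Real.pi * y : ℝ) * h)) := by
    congr 1
    push_cast
    ring
  rw [he, mul_comm (4 * Real.pi * y) h, ofReal_mul h, ofReal_mul_cpow hh]
  rw [show w + κ + (w - κ) = w + w by ring] at key
  have h2pi : ((2 * Real.pi : ℝ) : ℂ) ^ (w + w) =
      (4 : ℂ) ^ w * (Real.pi : ℂ) ^ w * (Real.pi : ℂ) ^ w := by
    rw [cpow_add _ _ (ofReal_ne_zero.2 (by positivity)), ofReal_mul,
      ofReal_mul_cpow two_pos]
    have : (4 : ℂ) ^ w = (2 : ℝ) ^ w * (2 : ℝ) ^ w := by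
      rw [← ofReal_mul_cpow two_pos]; norm_num
    rw [this]
    ring
  have h4 : ((4 * Real.pi * y : ℝ) : ℂ) ^ (1 - w) * (((4 * Real.pi * y : ℝ) : ℂ) *
      ((4 * Real.pi * y : ℝ) : ℂ) ^ (2 * w - 2)) =
      (4 : ℂ) ^ w * (Real.pi : ℂ) ^ w * (y : ℂ) ^ w := by
    have : ((4 * Real.pi * y : ℝ) : ℂ) ^ w = (4 : ℂ) ^ w * (Real.pi : ℂ) ^ w * (y : ℂ) ^ w := by
      rw [ofReal_mul, ofReal_mul_cpow (by positivity), ofReal_mul, ofReal_mul_cpow (by positivity)]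
      norm_num
    rw [← this]
    nth_rw 2 [← cpow_one ((4 * Real.pi * y : ℝ) : ℂ)]
    rw [← cpow_add _ _ hc', ← cpow_add _ _ hc']
    ring_nf
  rw [h2pi] at key
  set J := ∫ t in Ioi (0 : ℝ), (t : ℂ) ^ (w - κ - 1) * ((t : ℂ) + h) ^ (w + κ - 1) *
        cexp (-((4 * Real.pi * y : ℝ) * t))
  have hpw : (Real.pi : ℂ) ^ (-w) * (Real.pi : ℂ) ^ w = 1 := by
    rw [← cpow_add _ _ hpi]; simp
  linear_combination ((h : ℂ) ^ (1 - w) * cexp (-((2 * Real.pi * y : ℝ) * h)) * J) * h4 -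
    ((h : ℂ) ^ (1 - w) * (y : ℂ) ^ w * (Real.pi : ℂ) ^ (-w)) * key -
    ((h : ℂ) ^ (1 - w) * (y : ℂ) ^ w * (4 : ℂ) ^ w * (Real.pi : ℂ) ^ w *
      cexp (-((2 * Real.pi * y : ℝ) * h)) * J) * hpw

/-! ### Holomorphy in `κ` and the Whittaker function -/

theorem differentiable_eisKer_shift (w : ℂ) {y : ℝ} (hy : 0 < y) (x : ℝ) :
    Differentiable ℂ fun κ : ℂ => eisKer (w + κ) (w - κ) y x := by
  intro κ
  refine DifferentiableAt.mul ?_ ?_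
  · exact DifferentiableAt.const_cpow (by fun_prop)
      (Or.inl (slitPlane_ne_zero (sub_mul_I_mem_slitPlane hy x)))
  · exact DifferentiableAt.const_cpow (by fun_prop)
      (Or.inl (slitPlane_ne_zero (add_mul_I_mem_slitPlane hy x)))

/-- The exponents add up to 2w, so the decay rate in x does not depend on κ. Only the factor
exp(π(|Im α| + |Im β|)) varies, and it is bounded on horizontal strips; hence holomorphy on all of
ℂ. -/
theorem differentiable_fourier_eisKer {w : ℂ} (hw : 1 < 2 * w.re) {y : ℝ} (hy : 0 < y) (h : ℝ) :
    Differentiable ℂ fun κ : ℂ => 𝓕 (eisKer (w + κ) (w - κ) y) h := by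
  rw [← differentiableOn_univ]
  simp only [Real.fourier_real_eq_integral_exp_smul, smul_eq_mul]
  have hsum : ∀ κ : ℂ, ((w + κ) + (w - κ)).re = 2 * w.re := fun κ => by simp; ring
  refine differentiableOn_integral_of_dominated isOpen_univ (fun κ _ => ?_)
    (ae_of_all _ fun x => ?_) (fun κ₀ _ => ?_)
  · exact Continuous.aestronglyMeasurable
      (Continuous.mul (by fun_prop) (continuous_eisKer _ _ hy))
  · exact ((differentiable_eisKer_shift w hy x).const_mul _).differentiableOn
  · refine ⟨{κ | |κ.im| < |κ₀.im| + 1},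
      (isOpen_lt (continuous_abs.comp continuous_im) continuous_const).mem_nhds (by simp),
      fun x => Real.exp (Real.pi * (2 * |w.im| + 2 * (|κ₀.im| + 1))) *
        (min y 1 / 2) ^ (-(2 * w.re)) * (1 + |x|) ^ (-(2 * w.re)),
      (integrable_one_add_abs_rpow hw).const_mul _, ae_of_all _ fun x κ hκ => ?_⟩
    have hκ' : |κ.im| < |κ₀.im| + 1 := hκ
    rw [norm_mul, norm_exp_ofReal_mul_I, one_mul]
    have hm : 0 < min y 1 / 2 := by positivity
    have hb := norm_eisKer_le_rpow (w + κ) (w - κ) hy (by rw [hsum]; linarith) x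
    rw [hsum] at hb
    refine hb.trans ?_
    have h1 : |(w + κ).im| ≤ |w.im| + |κ.im| := by simpa using abs_add_le w.im κ.im
    have h2 : |(w - κ).im| ≤ |w.im| + |κ.im| := by simpa using abs_sub w.im κ.im
    have h3 : |(w + κ).im| + |(w - κ).im| ≤ 2 * |w.im| + 2 * (|κ₀.im| + 1) := by linarith
    beta_reduce
    gcongr

theorem eq_of_differentiable_of_eventuallyEq {f g : ℂ → ℂ} (hf : Differentiable ℂ f)
    (hg : Differentiable ℂ g) {z : ℂ} (h : f =ᶠ[𝓝 z] g) : f = g :=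
  AnalyticOnNhd.eq_of_eventuallyEq (hf.differentiableOn.analyticOnNhd isOpen_univ)
    (hg.differentiableOn.analyticOnNhd isOpen_univ) h

theorem eventually_re_region {w : ℂ} (hw : 1 < w.re) :
    ∀ᶠ κ : ℂ in 𝓝 0, 1 < (w + κ).re ∧ 0 < (w - κ).re := by
  have h1 : IsOpen {κ : ℂ | 1 < (w + κ).re} := isOpen_lt continuous_const (by fun_prop)
  have h2 : IsOpen {κ : ℂ | 0 < (w - κ).re} := isOpen_lt continuous_const (by fun_prop)
  have m1 : (0 : ℂ) ∈ {κ : ℂ | 1 < (w + κ).re} := by simpa using hw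
  have m2 : (0 : ℂ) ∈ {κ : ℂ | 0 < (w - κ).re} := by simp; linarith
  filter_upwards [h1.mem_nhds m1, h2.mem_nhds m2] with κ k1 k2 using ⟨k1, k2⟩

/-- The Fourier transform of the kernel at zero. -/
theorem fourier_eisKer_zero {w : ℂ} (hw : 1 < w.re) (κ : ℂ) {y : ℝ} (hy : 0 < y) :
    𝓕 (eisKer (w + κ) (w - κ) y) 0 = ((2 * Real.pi : ℝ) : ℂ) ^ (2 * w) *
      (((4 * Real.pi * y : ℝ) : ℂ) ^ (1 - 2 * w) * Gamma (2 * w - 1)) *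
        ((Gamma (w + κ))⁻¹ * (Gamma (w - κ))⁻¹) := by
  have hd : Differentiable ℂ fun κ => ((2 * Real.pi : ℝ) : ℂ) ^ (2 * w) *
      (((4 * Real.pi * y : ℝ) : ℂ) ^ (1 - 2 * w) * Gamma (2 * w - 1)) *
        ((Gamma (w + κ))⁻¹ * (Gamma (w - κ))⁻¹) := by
    refine Differentiable.const_mul (Differentiable.mul ?_ ?_) _
    · exact differentiable_one_div_Gamma.comp (by fun_prop : Differentiable ℂ fun κ => w + κ)
    · exact differentiable_one_div_Gamma.comp (by fun_prop : Differentiable ℂ fun κ => w - κ)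
  refine congrFun (eq_of_differentiable_of_eventuallyEq
    (differentiable_fourier_eisKer (by linarith) hy 0) hd (z := 0) ?_) κ
  filter_upwards [eventually_re_region hw] with κ hκ
  have key := fourier_eisKer_zero_of_re hκ.1 hκ.2 hy
  have hΓ1 : Gamma (w + κ) ≠ 0 := Gamma_ne_zero_of_re_pos (by linarith [hκ.1])
  have hΓ2 : Gamma (w - κ) ≠ 0 := Gamma_ne_zero_of_re_pos hκ.2
  rw [show w + κ + (w - κ) = 2 * w by ring] at key
  rw [← mul_inv, eq_mul_inv_iff_mul_eq₀ (mul_ne_zero hΓ1 hΓ2), ← key]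
  ring

theorem integrableOn_exp_mul_rpow_mul_add_rpow {a c y : ℝ} (ha : 0 < a) (hy : 0 < y) :
    IntegrableOn (fun u : ℝ => Real.exp (-u) * u ^ (a - 1) * (u + y) ^ c) (Ioi 0) := by
  have h1 : IntegrableOn (fun u : ℝ => Real.exp (-u) * u ^ (a - 1)) (Ioi 0) :=
    Real.GammaIntegral_convergent ha
  have hmeas : AEStronglyMeasurable (fun u : ℝ => Real.exp (-u) * u ^ (a - 1) * (u + y) ^ c)
      (volume.restrict (Ioi 0)) := by
    refine h1.aestronglyMeasurable.mul
      (ContinuousOn.aestronglyMeasurable (fun u hu => ?_) measurableSet_Ioi)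
    have hu' : 0 < u := hu
    exact ((continuousAt_id.add continuousAt_const).rpow_const
      (Or.inl (by simp; linarith))).continuousWithinAt
  rcases le_total c 0 with hc | hc
  · refine (h1.mul_const (y ^ c)).mono' hmeas ?_
    filter_upwards [ae_restrict_mem measurableSet_Ioi] with u hu
    have hu' : 0 < u := hu
    rw [Real.norm_of_nonneg (by positivity)]
    gcongr ?_ * ?_
    exact Real.rpow_le_rpow_of_nonpos hy (by linarith) hc
  · have h2 : IntegrableOn (fun u : ℝ => Real.exp (-u) * u ^ (a + c - 1)) (Ioi 0) :=
      Real.GammaIntegral_convergent (by linarith)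
    refine ((h2.const_mul (2 ^ c)).add (h1.mul_const (2 ^ c * y ^ c))).mono' hmeas ?_
    filter_upwards [ae_restrict_mem measurableSet_Ioi] with u hu
    have hu' : 0 < u := hu
    rw [Real.norm_of_nonneg (by positivity)]
    have hle : (u + y) ^ c ≤ 2 ^ c * (u ^ c + y ^ c) := by
      have h3 : (u + y) ^ c ≤ (2 * max u y) ^ c := by
        gcongr
        linarith [le_max_left u y, le_max_right u y]
      rw [Real.mul_rpow two_pos.le (by positivity)] at h3
      refine h3.trans (mul_le_mul_of_nonneg_left ?_ (by positivity))
      rcases max_cases u y with h | h <;> rw [h.1]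
      · linarith [Real.rpow_nonneg hy.le c]
      · linarith [Real.rpow_nonneg hu'.le c]
    calc Real.exp (-u) * u ^ (a - 1) * (u + y) ^ c
        ≤ Real.exp (-u) * u ^ (a - 1) * (2 ^ c * (u ^ c + y ^ c)) := by gcongr
      _ = 2 ^ c * (Real.exp (-u) * u ^ (a + c - 1)) +
          Real.exp (-u) * u ^ (a - 1) * (2 ^ c * y ^ c) := by
        rw [show a + c - 1 = (a - 1) + c by ring, Real.rpow_add hu']
        ring

theorem differentiableOn_whittakerIntegral (μ : ℂ) {y : ℝ} (hy : 0 < y) :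
    DifferentiableOn ℂ (fun κ => whittakerIntegral κ μ y) {κ | κ.re < μ.re + 1 / 2} := by
  have hU : IsOpen {κ : ℂ | κ.re < μ.re + 1 / 2} := isOpen_lt continuous_re continuous_const
  unfold whittakerIntegral
  refine DifferentiableOn.mul ?_ ?_
  · simp only [div_eq_mul_inv]
    exact (Differentiable.const_mul (differentiable_one_div_Gamma.comp
      (by fun_prop : Differentiable ℂ fun κ => μ + 1 * 2⁻¹ - κ)) _).differentiableOn
  refine differentiableOn_integral_of_dominated hU (fun κ _ => ?_) ?_ (fun κ₀ hκ₀ => ?_)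
  · refine ContinuousOn.aestronglyMeasurable (fun u hu => ?_) measurableSet_Ioi
    have hu' : 0 < u := hu
    refine ContinuousAt.continuousWithinAt (ContinuousAt.mul (ContinuousAt.mul (by fun_prop) ?_) ?_)
    · exact continuous_ofReal.continuousAt.cpow continuousAt_const (Or.inl (by simpa using hu'))
    · exact (continuous_ofReal.continuousAt.add continuousAt_const).cpow continuousAt_const
        (Or.inl (by simp; linarith))
  · filter_upwards [ae_restrict_mem measurableSet_Ioi] with u hu
    have hu' : 0 < u := hu
    have h1 : (u : ℂ) ≠ 0 := ofReal_ne_zero.2 hu'.ne'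
    have h2 : (u : ℂ) + y ≠ 0 := by
      rw [← ofReal_add]
      exact ofReal_ne_zero.2 (by positivity)
    intro κ _
    refine DifferentiableAt.differentiableWithinAt ?_
    refine ((differentiableAt_const _).mul ?_).mul ?_
    · exact DifferentiableAt.const_cpow (by fun_prop) (Or.inl h1)
    · exact DifferentiableAt.const_cpow (by fun_prop) (Or.inl h2)
  · have hκ : κ₀.re < μ.re + 1 / 2 := hκ₀
    set b : ℝ := (κ₀.re + μ.re + 1 / 2) / 2
    have hb1 : κ₀.re < b := by simp only [b]; linarith
    have hb2 : b < μ.re + 1 / 2 := by simp only [b]; linarith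
    refine ⟨{κ | κ.re < b}, (isOpen_lt continuous_re continuous_const).mem_nhds hb1, _,
      integrableOn_exp_mul_rpow_mul_add_rpow (a := μ.re + 1 / 2 - b) (c := μ.re + b - 1 / 2)
        (by linarith) hy, ?_⟩
    filter_upwards [ae_restrict_mem measurableSet_Ioi] with u hu κ hκb
    have hu' : 0 < u := hu
    have huy : 0 < u + y := by positivity
    have hκb' : κ.re < b := hκb
    rw [norm_mul, norm_mul, norm_exp, norm_cpow_eq_rpow_re_of_pos hu', ← ofReal_add,
      norm_cpow_eq_rpow_re_of_pos huy]
    have e1 : (μ - κ - 1 / 2).re = (μ.re + 1 / 2 - b - 1) + (b - κ.re) := by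
      simp; ring
    have e2 : μ.re + b - 1 / 2 = (b - κ.re) + (μ + κ - 1 / 2).re := by
      simp; ring
    rw [e1, e2, Real.rpow_add hu', Real.rpow_add huy]
    -- The surplus b - Re κ > 0 of the exponent of u is transferred to u + y. This gives one bound
    -- for small and large u alike, with total exponent independent of κ.
    have e3 : u ^ (b - κ.re) ≤ (u + y) ^ (b - κ.re) := by
      gcongr
      linarith
    calc Real.exp (-(u : ℂ)).re * (u ^ (μ.re + 1 / 2 - b - 1) * u ^ (b - κ.re)) *
          (u + y) ^ (μ + κ - 1 / 2).re
        ≤ Real.exp (-(u : ℂ)).re * (u ^ (μ.re + 1 / 2 - b - 1) * (u + y) ^ (b - κ.re)) *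
          (u + y) ^ (μ + κ - 1 / 2).re := by gcongr
      _ = _ := by rw [neg_re, ofReal_re]; ring

/-- The continuation of the Whittaker integral exists for `Re μ > 1/2`. -/
theorem exists_isWhittakerContinuation {w : ℂ} (hw : 1 < w.re) {h y : ℝ} (hh : 0 < h)
    (hy : 0 < y) : ∃ F, IsWhittakerContinuation (w - 1 / 2) (4 * Real.pi * h * y) F := by
  have hY : 0 < 4 * Real.pi * h * y := by positivity
  set μ := w - 1 / 2 with hμ
  have hμre : μ.re + 1 / 2 = w.re := by simp [hμ]
  set W : ℂ → ℂ := fun κ => whittakerIntegral κ μ (4 * Real.pi * h * y)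
  -- The integral W is holomorphic for Re κ < Re w, and V for Re κ > -Re w, where Γ(w + κ) has no
  -- pole. These half planes cover ℂ, and W = V on the convex overlap because they agree near 0;
  -- glueing them gives the entire function.
  set V : ℂ → ℂ := fun κ => (h : ℂ) ^ (1 - w) * (y : ℂ) ^ w * (Real.pi : ℂ) ^ (-w) *
    Gamma (w + κ) * 𝓕 (eisKer (w + κ) (w - κ) y) h
  have hWd : DifferentiableOn ℂ W {κ | κ.re < w.re} := by
    rw [← hμre]
    exact differentiableOn_whittakerIntegral μ hY
  have hVd : DifferentiableOn ℂ V {κ | -w.re < κ.re} := by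
    intro κ hκ
    have hκ' : -w.re < κ.re := hκ
    refine DifferentiableAt.differentiableWithinAt ?_
    refine (DifferentiableAt.const_mul ?_ _).mul (differentiable_fourier_eisKer (by linarith) hy h κ)
    refine (differentiableAt_Gamma _ fun m hm => ?_).comp κ (by fun_prop)
    have := congrArg re hm
    simp at this
    have hm0 : (0 : ℝ) ≤ m := m.cast_nonneg
    linarith
  have ho1 : IsOpen {κ : ℂ | κ.re < w.re} := isOpen_lt continuous_re continuous_const
  have ho2 : IsOpen {κ : ℂ | -w.re < κ.re} := isOpen_lt continuous_const continuous_re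
  have hconv : Convex ℝ ({κ : ℂ | κ.re < w.re} ∩ {κ : ℂ | -w.re < κ.re}) :=
    (convex_halfSpace_re_lt _).inter (convex_halfSpace_re_gt _)
  have hagree : EqOn W V ({κ : ℂ | κ.re < w.re} ∩ {κ : ℂ | -w.re < κ.re}) := by
    refine ((hWd.mono inter_subset_left).analyticOnNhd (ho1.inter ho2)).eqOn_of_preconnected_of_eventuallyEq
      ((hVd.mono inter_subset_right).analyticOnNhd (ho1.inter ho2)) hconv.isPreconnected
      (z₀ := 0) ⟨by simp; linarith, by simp; linarith⟩ ?_
    filter_upwards [eventually_re_region hw] with κ hκ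
    exact fourier_eisKer_eq_whittakerIntegral hκ.1 hκ.2 hy hh
  refine ⟨fun κ => if κ.re < w.re then W κ else V κ, fun κ => ?_, fun κ hκ => ?_⟩
  · rcases lt_or_ge κ.re w.re with hκ | hκ
    · refine (hWd.differentiableAt (ho1.mem_nhds hκ)).congr_of_eventuallyEq ?_
      filter_upwards [ho1.mem_nhds hκ] with κ' hκ'
      exact if_pos hκ'
    · have hκ2 : -w.re < κ.re := by linarith
      refine (hVd.differentiableAt (ho2.mem_nhds hκ2)).congr_of_eventuallyEq ?_
      filter_upwards [ho2.mem_nhds hκ2] with κ' hκ'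
      by_cases h1 : κ'.re < w.re
      · rw [if_pos h1]
        exact hagree ⟨h1, hκ'⟩
      · rw [if_neg h1]
  · rw [hμre] at hκ
    exact if_pos hκ

theorem isWhittakerContinuation_whittakerW {w : ℂ} (hw : 1 < w.re) {h y : ℝ} (hh : 0 < h)
    (hy : 0 < y) : IsWhittakerContinuation (w - 1 / 2) (4 * Real.pi * h * y)
      (fun κ => whittakerW κ (w - 1 / 2) (4 * Real.pi * h * y)) := by
  have hex := exists_isWhittakerContinuation hw hh hy
  have : (fun κ => whittakerW κ (w - 1 / 2) (4 * Real.pi * h * y)) = hex.choose := by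
    funext κ
    rw [whittakerW, dif_pos hex]
  rw [this]
  exact hex.choose_spec

/-- The Fourier transform of the kernel at a positive frequency is a Whittaker function. -/
theorem whittakerW_div_Gamma {w : ℂ} (hw : 1 < w.re) (κ : ℂ) {h y : ℝ} (hh : 0 < h)
    (hy : 0 < y) :
    (Gamma (w + κ))⁻¹ * whittakerW κ (w - 1 / 2) (4 * Real.pi * h * y) =
      (h : ℂ) ^ (1 - w) * (y : ℂ) ^ w * (Real.pi : ℂ) ^ (-w) *
        𝓕 (eisKer (w + κ) (w - κ) y) h := by
  have hW := isWhittakerContinuation_whittakerW hw hh hy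
  -- Division by Γ(w + κ) makes both sides entire, so agreement near κ = 0 suffices, with no
  -- exception at the poles of Γ.
  have hd1 : Differentiable ℂ fun κ =>
      (Gamma (w + κ))⁻¹ * whittakerW κ (w - 1 / 2) (4 * Real.pi * h * y) :=
    (differentiable_one_div_Gamma.comp (by fun_prop : Differentiable ℂ fun κ => w + κ)).mul hW.1
  have hd2 : Differentiable ℂ fun κ => (h : ℂ) ^ (1 - w) * (y : ℂ) ^ w * (Real.pi : ℂ) ^ (-w) *
        𝓕 (eisKer (w + κ) (w - κ) y) h :=
    (differentiable_fourier_eisKer (by linarith) hy h).const_mul _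
  refine congrFun (eq_of_differentiable_of_eventuallyEq hd1 hd2 (z := 0) ?_) κ
  filter_upwards [eventually_re_region hw] with κ hκ
  have hΓ1 : Gamma (w + κ) ≠ 0 := Gamma_ne_zero_of_re_pos (by linarith [hκ.1])
  have h2 : 0 < w.re - κ.re := by simpa using hκ.2
  have h3 : whittakerW κ (w - 1 / 2) (4 * Real.pi * h * y) = _ := hW.2 κ (by simp; linarith)
  rw [h3, fourier_eisKer_eq_whittakerIntegral hκ.1 hκ.2 hy hh]
  field_simp

/-! ### Poisson summation for the kernel -/

/-- The product `𝓕((y - i·)^{-α} (y + i·)^{-β})(h) e^{2πihx}`. -/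
noncomputable def fourierTerm (α β : ℂ) (y x h : ℝ) : ℂ :=
  𝓕 (eisKer α β y) h * cexp (2 * Real.pi * I * h * x)

theorem norm_fourierTerm (α β : ℂ) (y x h : ℝ) :
    ‖fourierTerm α β y x h‖ = ‖𝓕 (eisKer α β y) h‖ := by
  rw [fourierTerm, norm_mul, show (2 * Real.pi * I * h * x : ℂ) =
    ((2 * Real.pi * h * x : ℝ) : ℂ) * I by push_cast; ring, norm_exp_ofReal_mul_I, mul_one]

theorem fourierTerm_mul (α β : ℂ) {c : ℝ} (hc : 0 < c) (y x h : ℝ) :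
    fourierTerm α β (c * y) (c * x) h =
      (c : ℂ) ^ (1 - α - β) * fourierTerm α β y x (c * h) := by
  rw [fourierTerm, fourierTerm, fourier_eisKer_mul_left α β hc]
  push_cast
  ring_nf

theorem exists_norm_fourierTerm_le {α β : ℂ} {y : ℝ} (x : ℝ) (hy : 0 < y)
    (hre : 1 < (α + β).re) : ∃ C : ℝ, ∀ h : ℝ, ‖fourierTerm α β y x h‖ ≤ C * (1 + h ^ 2)⁻¹ := by
  obtain ⟨C₀, h₀⟩ := exists_norm_fourier_eisKer_mul_pow_le 0 hy hre
  obtain ⟨C₂, h₂⟩ := exists_norm_fourier_eisKer_mul_pow_le 2 hy hre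
  refine ⟨C₀ + C₂, fun h => ?_⟩
  have h0 := h₀ h
  have h2 := h₂ h
  rw [sq_abs] at h2
  rw [norm_fourierTerm, ← div_eq_mul_inv, le_div_iff₀ (by positivity)]
  linarith

theorem summable_int_inv_one_add_sq {c : ℝ} (hc : 1 ≤ c) :
    Summable fun n : ℤ => (1 + (c * n) ^ 2)⁻¹ := by
  refine Summable.of_norm_bounded_eventually
    ((Real.summable_one_div_int_pow (p := 2)).2 one_lt_two) ?_
  rw [eventually_cofinite]
  refine (finite_singleton (0 : ℤ)).subset fun n hn => ?_
  by_contra h0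
  refine hn ?_
  have hn0 : (n : ℝ) ≠ 0 := Int.cast_ne_zero.2 (by simpa using h0)
  have hpos : 0 < (n : ℝ) ^ 2 := by positivity
  rw [Real.norm_of_nonneg (by positivity), one_div]
  refine inv_anti₀ hpos ?_
  nlinarith [mul_pow c (n : ℝ) 2, one_le_pow₀ hc (n := 2)]

theorem summable_fourierTerm {α β : ℂ} {y : ℝ} (x : ℝ) (hy : 0 < y)
    (hre : 1 < (α + β).re) : Summable fun n : ℤ => fourierTerm α β y x n := by
  obtain ⟨C, hC⟩ := exists_norm_fourierTerm_le x hy hre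
  refine Summable.of_norm_bounded ((summable_int_inv_one_add_sq le_rfl).mul_left C) fun n => ?_
  simpa using hC n

/-- Poisson summation: the kernel decays like |x|^{-Re(α+β)} with exponent beyond 1, and its
transform is summable over ℤ. -/
theorem tsum_eisKer {α β : ℂ} {y : ℝ} (x : ℝ) (hy : 0 < y) (hre : 1 < (α + β).re) :
    ∑' n : ℤ, eisKer α β y (x + n) = ∑' n : ℤ, fourierTerm α β y x n := by
  have hsum : Summable fun n : ℤ => 𝓕 (eisKer α β y) n := by
    have := summable_fourierTerm (y := y) 0 hy hre
    simpa [fourierTerm] using this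
  have hO : eisKer α β y =O[cocompact ℝ] fun x : ℝ => |x| ^ (-(α + β).re) := by
    refine Asymptotics.IsBigO.of_bound (Real.exp (Real.pi * (|α.im| + |β.im|)) *
      (min y 1 / 2) ^ (-(α + β).re)) ?_
    have hne : ∀ᶠ x : ℝ in cocompact ℝ, x ≠ 0 :=
      (isCompact_singleton (x := (0 : ℝ))).compl_mem_cocompact
    filter_upwards [hne] with x hx
    refine (norm_eisKer_le_rpow α β hy (by linarith) x).trans ?_
    have hm : 0 < min y 1 / 2 := by positivity
    rw [Real.norm_of_nonneg (by positivity)]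
    refine mul_le_mul_of_nonneg_left ?_ (by positivity)
    exact Real.rpow_le_rpow_of_nonpos (abs_pos.2 hx) (by linarith) (by linarith)
  rw [Real.tsum_eq_tsum_fourier_of_rpow_decay_of_summable (continuous_eisKer α β hy) hre hO hsum]
  refine tsum_congr fun n => ?_
  rw [fourier_coe_apply, fourierTerm]
  simp

/-! ### The function `|w|^{-2s} w^{-k}` -/

/-- The function `w ↦ |w|^{-2s} w^{-k}`. -/
noncomputable def eisPhi (k : ℤ) (s w : ℂ) : ℂ := ((‖w‖ : ℂ) ^ (2 * s) * w ^ k)⁻¹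

theorem eisTerm_eq (k : ℤ) (z : UpperHalfPlane) (s w : ℂ) :
    eisTerm k z s w = (z.im : ℂ) ^ s * eisPhi k s w :=
  div_eq_mul_inv _ _

theorem eisPhi_ofReal_mul (k : ℤ) (s w : ℂ) {c : ℝ} (hc : 0 < c) :
    eisPhi k s (c * w) = (c : ℂ) ^ (-(2 * s + k)) * eisPhi k s w := by
  have hc' : (c : ℂ) ≠ 0 := ofReal_ne_zero.2 hc.ne'
  rw [eisPhi, eisPhi, norm_mul, norm_real, Real.norm_of_nonneg hc.le, ofReal_mul,
    ofReal_mul_cpow hc, mul_zpow, cpow_neg, cpow_add _ _ hc', cpow_intCast, ← mul_inv]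
  ring_nf

theorem eisPhi_neg {k : ℤ} (hk : Even k) (s w : ℂ) : eisPhi k s (-w) = eisPhi k s w := by
  rw [eisPhi, eisPhi, norm_neg, hk.neg_zpow]

/-- The value at 0 is a convention (0⁻¹ = 0; for k = 0 the hypothesis forces s ≠ 0). It lets sums
run over the full lattice, origin included. -/
theorem eisPhi_zero {k : ℤ} {s : ℂ} (hq : 2 < (2 * s + k).re) : eisPhi k s 0 = 0 := by
  rw [eisPhi, norm_zero, ofReal_zero]
  rcases eq_or_ne k 0 with rfl | hk
  · rw [zero_cpow, zero_mul, inv_zero]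
    intro h
    rw [h] at hq
    norm_num at hq
  · rw [zero_zpow _ hk, mul_zero, inv_zero]

theorem norm_eisPhi {k : ℤ} {s w : ℂ} (hw : w ≠ 0) :
    ‖eisPhi k s w‖ = ‖w‖ ^ (-(2 * s + k).re) := by
  have hw' : 0 < ‖w‖ := norm_pos_iff.2 hw
  rw [eisPhi, norm_inv, norm_mul, norm_cpow_eq_rpow_re_of_pos hw', norm_zpow,
    Real.rpow_neg hw'.le, ← Real.rpow_intCast, ← Real.rpow_add hw']
  simp

/-- Put a = y - ix, so x + iy = ia and i^k = (-1)^{k/2} for even k. Since a avoids the branch cut,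
log ā is the conjugate of log a, whence |a|^{2s} = a^s ā^s. -/
theorem eisPhi_eq_eisKer {k : ℤ} (hk : Even k) (s : ℂ) {y : ℝ} (hy : 0 < y) (x : ℝ) :
    eisPhi k s ((x : ℂ) + y * I) = (-1 : ℂ) ^ (k / 2) * eisKer (s + k) s y x := by
  obtain ⟨j, rfl⟩ := hk
  have hj : (j + j) / 2 = j := by omega
  set a : ℂ := (y : ℂ) - x * I with ha
  have hmem : a ∈ slitPlane := sub_mul_I_mem_slitPlane hy x
  have ha0 : a ≠ 0 := slitPlane_ne_zero hmem
  have hconj : (y : ℂ) + x * I = (starRingEnd ℂ) a := by simp [ha]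
  have hw : (x : ℂ) + y * I = I * a := by
    rw [ha]
    linear_combination (x : ℂ) * I_mul_I
  have hnorm : ‖(x : ℂ) + y * I‖ = ‖a‖ := by rw [hw]; simp
  have hb0 : (starRingEnd ℂ) a ≠ 0 := by simpa using ha0
  have hab : a ^ s * (starRingEnd ℂ) a ^ s = (‖a‖ : ℂ) ^ (2 * s) := by
    rw [cpow_def_of_ne_zero ha0, cpow_def_of_ne_zero hb0,
      cpow_def_of_ne_zero (by simpa using ha0), ← Complex.exp_add, log_conj a
        (mem_slitPlane_iff_arg.1 hmem).1, ← add_mul, add_conj, log_re, ← ofReal_log (norm_nonneg _)]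
    push_cast
    ring_nf
  rw [eisPhi, hnorm, hw, eisKer, hconj, ← hab, hj, cpow_neg, cpow_neg, cpow_add _ _ ha0,
    cpow_intCast, mul_zpow, zpow_add₀ I_ne_zero, ← mul_zpow, I_mul_I]
  have h1 : ((-1 : ℂ) ^ j)⁻¹ = (-1) ^ j := by
    rw [← inv_zpow]; norm_num
  rw [mul_inv, mul_inv, mul_inv, mul_inv, h1]
  ring

/-! ### Grouping a double series by the product of the indices -/

/-- The divisor sum `σ_ν(n)`, with the value `ζ(-ν)` at `n = 0`. -/
noncomputable def sigmaExt (ν : ℂ) (n : ℤ) : ℂ := if n = 0 then riemannZeta (-ν) else sigmaC ν n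

theorem tsum_pnat_cpow {ν : ℂ} (hν : ν.re < -1) :
    ∑' m : ℕ+, ((m : ℕ) : ℂ) ^ ν = riemannZeta (-ν) := by
  rw [zeta_eq_tsum_one_div_nat_add_one_cpow (by simpa using by linarith),
    tsum_pnat_eq_tsum_succ (f := fun m : ℕ => (m : ℂ) ^ ν)]
  refine tsum_congr fun n => ?_
  rw [cpow_neg, one_div, inv_inv]
  push_cast
  rfl

theorem summable_pnat_rpow {c : ℝ} (hc : c < -1) : Summable fun m : ℕ+ => ((m : ℕ) : ℝ) ^ c :=
  (Real.summable_nat_rpow.2 hc).comp_injective PNat.coe_injective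

/-- The fibre over `0` of `(m, r) ↦ mr`. -/
def fiberZeroEquiv : ℕ+ ≃ (fun p : ℕ+ × ℤ => ((p.1 : ℕ) : ℤ) * p.2) ⁻¹' {0} where
  toFun m := ⟨(m, 0), by simp⟩
  invFun p := p.1.1
  left_inv _ := rfl
  right_inv p := by
    obtain ⟨⟨m, r⟩, h⟩ := p
    have h' : ((m : ℕ) : ℤ) * r = 0 := h
    have hr : r = 0 := (mul_eq_zero.1 h').resolve_left (by exact_mod_cast m.ne_zero)
    subst hr
    rfl

/-- The fibre over `n ≠ 0` of `(m, r) ↦ mr`. -/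
def fiberEquiv {n : ℤ} (hn : n ≠ 0) :
    n.natAbs.divisors ≃ (fun p : ℕ+ × ℤ => ((p.1 : ℕ) : ℤ) * p.2) ⁻¹' {n} where
  toFun d := ⟨(⟨d.1, Nat.pos_of_mem_divisors d.2⟩, n / d.1), by
    have : (d.1 : ℤ) ∣ n := Int.natCast_dvd.2 (Nat.dvd_of_mem_divisors d.2)
    simpa using Int.mul_ediv_cancel' this⟩
  invFun p := ⟨p.1.1, by
    have h : ((p.1.1 : ℕ) : ℤ) * p.1.2 = n := p.2
    exact Nat.mem_divisors.2 ⟨Int.natCast_dvd.1 ⟨_, h.symm⟩, Int.natAbs_ne_zero.2 hn⟩⟩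
  left_inv _ := rfl
  right_inv p := by
    obtain ⟨⟨m, r⟩, h⟩ := p
    have h' : ((m : ℕ) : ℤ) * r = n := h
    have hr : n / ((m : ℕ) : ℤ) = r := by
      rw [← h']
      exact Int.mul_ediv_cancel_left _ (by exact_mod_cast m.ne_zero)
    refine Subtype.ext (Prod.ext rfl hr)

theorem tsum_fiber {ν : ℂ} (hν : ν.re < -1) (n : ℤ) :
    ∑' p : (fun p : ℕ+ × ℤ => ((p.1 : ℕ) : ℤ) * p.2) ⁻¹' {n}, ((p.1.1 : ℕ) : ℂ) ^ ν =
      sigmaExt ν n := by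
  rw [sigmaExt]
  split_ifs with hn
  · subst hn
    rw [← fiberZeroEquiv.tsum_eq, ← tsum_pnat_cpow hν]
    rfl
  · rw [← (fiberEquiv hn).tsum_eq, sigmaC, ← Finset.tsum_subtype]
    rfl

/-- Group the absolutely convergent double sum over (m, r) by n = mr. For n ≠ 0 the fibre is the set
of divisors of n; for n = 0 it is r = 0 with m arbitrary, which gives ζ(-ν). -/
theorem hasSum_sigmaExt_mul {ν : ℂ} (hν : ν.re < -1) {c : ℤ → ℂ} {C : ℝ}
    (hc : ∀ n, ‖c n‖ ≤ C * (1 + (n : ℝ) ^ 2)⁻¹) :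
    HasSum (fun n => sigmaExt ν n * c n)
      (∑' m : ℕ+, ((m : ℕ) : ℂ) ^ ν * ∑' r : ℤ, c ((m : ℕ) * r)) := by
  have hC : 0 ≤ C := by
    have := (norm_nonneg _).trans (hc 0)
    simpa using this
  have hsum : Summable fun p : ℕ+ × ℤ => ((p.1 : ℕ) : ℂ) ^ ν * c ((p.1 : ℕ) * p.2) := by
    have h1 : Summable fun r : ℤ => C * (1 + (r : ℝ) ^ 2)⁻¹ := by
      simpa using (summable_int_inv_one_add_sq le_rfl).mul_left C
    refine Summable.of_norm_bounded ((summable_pnat_rpow hν).mul_of_nonneg h1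
      (fun m => by positivity) (fun r => by positivity)) fun p => ?_
    have hm : (1 : ℝ) ≤ (p.1 : ℕ) := by exact_mod_cast p.1.pos
    rw [norm_mul, norm_natCast_cpow_of_pos p.1.pos]
    refine mul_le_mul_of_nonneg_left ((hc _).trans ?_) (by positivity)
    refine mul_le_mul_of_nonneg_left (inv_anti₀ (by positivity) ?_) hC
    push_cast
    rw [mul_pow]
    nlinarith [sq_nonneg (p.2 : ℝ), one_le_pow₀ hm (n := 2)]
  have key := hsum.hasSum.tsum_fiberwise fun p : ℕ+ × ℤ => ((p.1 : ℕ) : ℤ) * p.2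
  rw [hsum.tsum_prod] at key
  simp only [tsum_mul_left] at key
  refine key.congr_fun fun n => ?_
  rw [← tsum_fiber hν n, ← tsum_mul_right]
  refine tsum_congr fun p => ?_
  have hp : ((p.1.1 : ℕ) : ℤ) * p.1.2 = n := p.2
  rw [hp]

/-! ### The lattice sum -/

theorem summable_eisPhi_lattice {k : ℤ} {s : ℂ} (hq : 2 < (2 * s + k).re)
    (τ : UpperHalfPlane) :
    Summable fun p : ℤ × ℤ => eisPhi k s (p.1 * τ + p.2) := by
  rw [← (finTwoArrowEquiv ℤ).summable_iff]
  refine Summable.of_norm_bounded ((EisensteinSeries.summable_one_div_norm_rpow hq).mul_left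
    (EisensteinSeries.r τ ^ (-(2 * s + k).re))) fun x => ?_
  change ‖eisPhi k s ((x 0 : ℂ) * τ + x 1)‖ ≤ _
  rcases eq_or_ne ((x 0 : ℂ) * τ + x 1) 0 with h | h
  · rw [h, eisPhi_zero hq, norm_zero]
    have := (EisensteinSeries.r_pos τ).le
    positivity
  · rw [norm_eisPhi h]
    exact EisensteinSeries.summand_bound τ (by linarith) x

/-- The sum of `|w|^{-2s} w^{-k}` over the lattice `ℤτ + ℤ`. -/
noncomputable def latticeSum (k : ℤ) (s : ℂ) (τ : UpperHalfPlane) : ℂ :=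
  ∑' p : ℤ × ℤ, eisPhi k s (p.1 * τ + p.2)

theorem tsum_eisPhi_int {k : ℤ} (hk : Even k) {s : ℂ} (hq : 2 < (2 * s + k).re) :
    ∑' n : ℤ, eisPhi k s n = 2 * riemannZeta (2 * s + k) := by
  have hterm : ∀ m : ℕ+, eisPhi k s (((m : ℕ) : ℤ) : ℂ) = ((m : ℕ) : ℂ) ^ (-(2 * s + k)) := by
    intro m
    have hm : (0 : ℝ) < (m : ℕ) := by exact_mod_cast m.pos
    have := eisPhi_ofReal_mul k s 1 hm
    simpa [eisPhi] using this
  have hsum : Summable fun n : ℤ => eisPhi k s n := by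
    have := (summable_eisPhi_lattice hq UpperHalfPlane.I).prod_factor 0
    simpa using this
  rw [tsum_int_eq_zero_add_two_mul_tsum_pnat (fun n => by
    rw [Int.cast_neg, eisPhi_neg hk]) hsum, Int.cast_zero, eisPhi_zero hq, zero_add,
    tsum_congr hterm, tsum_pnat_cpow (by rw [neg_re]; linarith), neg_neg, nsmul_eq_mul]
  norm_num

/-- Poisson summation at mτ, followed by rescaling by m: the frequency r at mτ becomes mr at τ, at
the cost of m^{1-q}. -/
theorem tsum_eisPhi_row {k : ℤ} (hk : Even k) {s : ℂ} (hq : 2 < (2 * s + k).re)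
    (τ : UpperHalfPlane) (m : ℕ+) :
    ∑' n : ℤ, eisPhi k s (((m : ℕ) : ℤ) * τ + n) = ((m : ℕ) : ℂ) ^ (1 - (2 * s + k)) *
      ∑' r : ℤ, (-1 : ℂ) ^ (k / 2) * fourierTerm (s + k) s τ.im τ.re (((m : ℕ) * r : ℤ) : ℝ) := by
  have hm : (0 : ℝ) < (m : ℕ) := by exact_mod_cast m.pos
  have hy : 0 < (m : ℕ) * τ.im := mul_pos hm τ.im_pos
  have h1 : ∀ n : ℤ, eisPhi k s (((m : ℕ) : ℤ) * τ + n) =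
      (-1 : ℂ) ^ (k / 2) * eisKer (s + k) s ((m : ℕ) * τ.im) ((m : ℕ) * τ.re + n) := by
    intro n
    rw [← eisPhi_eq_eisKer hk s hy]
    congr 1
    conv_lhs => rw [← re_add_im (τ : ℂ)]
    push_cast
    rw [UpperHalfPlane.coe_re, UpperHalfPlane.coe_im]
    ring
  rw [tsum_congr h1, tsum_mul_left, tsum_mul_left, tsum_eisKer _ hy (by
    rw [show s + k + s = 2 * s + k by ring]; linarith)]
  simp only [fourierTerm_mul _ _ hm]
  rw [tsum_mul_left, mul_left_comm]
  push_cast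
  ring_nf

/-- The Fourier expansion of the lattice sum. -/
theorem hasSum_latticeSum {k : ℤ} (hk : Even k) {s : ℂ} (hq : 2 < (2 * s + k).re)
    (τ : UpperHalfPlane) :
    HasSum (fun n : ℤ => sigmaExt (1 - (2 * s + k)) n *
      ((-1 : ℂ) ^ (k / 2) * fourierTerm (s + k) s τ.im τ.re n))
      (latticeSum k s τ / 2 - riemannZeta (2 * s + k)) := by
  have hre : 1 < (s + k + s).re := by
    rw [show s + k + s = 2 * s + k by ring]; linarith
  obtain ⟨C, hC⟩ := exists_norm_fourierTerm_le τ.re τ.im_pos hre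
  have key := hasSum_sigmaExt_mul (ν := 1 - (2 * s + k))
    (c := fun n => (-1 : ℂ) ^ (k / 2) * fourierTerm (s + k) s τ.im τ.re n) (C := C)
    (by rw [sub_re, one_re]; linarith) (fun n => by simpa using hC n)
  -- Row 0 contributes 2ζ(q), and rows m and -m agree because φ is even.
  have hL : latticeSum k s τ = 2 * riemannZeta (2 * s + k) +
      2 * ∑' m : ℕ+, ∑' n : ℤ, eisPhi k s (((m : ℕ) : ℤ) * τ + n) := by
    have hs := summable_eisPhi_lattice hq τ
    rw [latticeSum, hs.tsum_prod, tsum_int_eq_zero_add_two_mul_tsum_pnat ?_ hs.prod]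
    · rw [nsmul_eq_mul, ← tsum_eisPhi_int hk hq]
      simp
    · intro m
      simp only
      rw [← (Equiv.neg ℤ).tsum_eq]
      refine tsum_congr fun n => ?_
      rw [← eisPhi_neg hk]
      congr 1
      simp
      ring
  rw [tsum_congr (tsum_eisPhi_row hk hq τ)] at hL
  convert key using 1
  rw [hL]
  ring

section

/-! ### The index sets of the Eisenstein series -/

/-- Membership says that gcd(Nm, n) divides m. Locally at p this reads min(v_p(N) + v_p(m), v_p(n))
≤ v_p(m), which is automatic for p ∤ N and means v_p(n) ≤ v_p(m) for p ∣ N. -/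
theorem mem_pairsL_iff {N : ℕ} (hN : N ≠ 0) (x : ℤ × ℤ) :
    x ∈ pairsL N ↔ x ≠ 0 ∧
      ∀ p ∈ N.primeFactors, ∀ e : ℕ, (p : ℤ) ^ e ∣ x.2 → (p : ℤ) ^ e ∣ x.1 := by
  obtain ⟨m, n⟩ := x
  constructor
  · rintro ⟨t, ht, htm, htn, h⟩
    simp only at htm htn h
    refine ⟨fun h0 => ?_, fun p hp e => ?_⟩
    · rw [Prod.mk_eq_zero] at h0
      rw [h0.1, h0.2] at h
      simp at h
      omega
    · simp only
      induction e with
      | zero => simp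
      | succ e ih =>
        intro hdvd
        have h1 : (p : ℤ) ^ e ∣ m := ih ((pow_dvd_pow _ e.le_succ).trans hdvd)
        have h2 : (p : ℤ) ^ (e + 1) ∣ N * m := by
          rw [pow_succ']
          exact mul_dvd_mul (by exact_mod_cast Nat.dvd_of_mem_primeFactors hp) h1
        have h3 := Int.dvd_coe_gcd h2 hdvd
        rw [h] at h3
        exact h3.trans htm
  · rintro ⟨h0, h⟩
    simp only at h
    refine ⟨Int.gcd (N * m) n, ?_, ?_, Int.gcd_dvd_right _ _, rfl⟩
    · rw [Int.gcd_pos_iff]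
      by_contra! hcon
      refine h0 ?_
      have : m = 0 := (mul_eq_zero.1 hcon.1).resolve_left (by exact_mod_cast hN)
      rw [this, hcon.2]
      rfl
    · simp only
      rw [Int.natCast_dvd, Nat.dvd_iff_prime_pow_dvd_dvd]
      intro p e hp hdvd
      have hd : ((p ^ e : ℕ) : ℤ) ∣ Int.gcd (N * m) n := Int.natCast_dvd_natCast.2 hdvd
      have hd1 := hd.trans (Int.gcd_dvd_left _ _)
      have hd2 := hd.trans (Int.gcd_dvd_right _ _)
      rw [← Int.natCast_dvd]
      by_cases hpN : p ∣ N
      · have := h p (Nat.mem_primeFactors.2 ⟨hp, hpN, hN⟩) e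
        push_cast at hd2 ⊢
        exact this hd2
      · refine IsCoprime.dvd_of_dvd_mul_left ?_ hd1
        exact Nat.isCoprime_iff_coprime.2 (((Nat.Prime.coprime_iff_not_dvd hp).2 hpN).pow_left e)

theorem swap_mem_pairsL_iff (N : ℕ) (x : ℤ × ℤ) : x.swap ∈ pairsL N ↔ x ∈ pairsR N := by
  simp only [pairsL, pairsR, mem_ofPred_eq, Prod.fst_swap, Prod.snd_swap]
  refine exists_congr fun t => ?_
  rw [Int.gcd_comm]
  tauto

/-- Nonzero pairs whose second entry is prime to `A`, and divides the first one locally at `B`. -/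
def localPairs (A B : Finset ℕ) : Set (ℤ × ℤ) :=
  {x | x ≠ 0 ∧ (∀ p ∈ A, ¬ (p : ℤ) ∣ x.2) ∧
    ∀ p ∈ B, ∀ e : ℕ, (p : ℤ) ^ e ∣ x.2 → (p : ℤ) ^ e ∣ x.1}

/-- Multiplication of a pair by a natural number. -/
def scalePair (c : ℕ) (x : ℤ × ℤ) : ℤ × ℤ := (c * x.1, c * x.2)

theorem scalePair_injective {c : ℕ} (hc : c ≠ 0) : Function.Injective (scalePair c) := by
  intro x y h
  simp only [scalePair, Prod.mk.injEq] at h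
  have hc' : (c : ℤ) ≠ 0 := by exact_mod_cast hc
  exact Prod.ext (mul_left_cancel₀ hc' h.1) (mul_left_cancel₀ hc' h.2)

theorem isCoprime_of_prime_ne {p l : ℕ} (hp : p.Prime) (hl : l.Prime) (h : p ≠ l) : IsCoprime (l : ℤ) p :=
  Nat.isCoprime_iff_coprime.2 ((Nat.coprime_primes hl hp).2 h.symm)

theorem scalePair_mem_localPairs_iff {A B : Finset ℕ} (hA : ∀ p ∈ A, p.Prime)
    (hB : ∀ p ∈ B, p.Prime) {p : ℕ} (hp : p.Prime) (hpA : p ∉ A) (hpB : p ∈ B)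
    (x : ℤ × ℤ) : scalePair p x ∈ localPairs A B ↔ x ∈ localPairs A B := by
  have hp0 : (p : ℤ) ≠ 0 := by exact_mod_cast hp.ne_zero
  simp only [localPairs, mem_ofPred_eq, scalePair]
  refine and_congr ?_ (and_congr ?_ ?_)
  · simp [Prod.ext_iff, hp.ne_zero]
  · refine forall₂_congr fun l hl => not_congr ?_
    have hcop := isCoprime_of_prime_ne hp (hA l hl) (fun h => hpA (h ▸ hl))
    exact ⟨fun h => hcop.dvd_of_dvd_mul_left h, fun h => h.mul_left _⟩
  · refine forall₂_congr fun l hl => ?_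
    by_cases hlp : l = p
    · subst hlp
      refine ⟨fun h e he => ?_, fun h e he => ?_⟩
      · have := h (e + 1)
        rw [pow_succ', mul_dvd_mul_iff_left hp0, mul_dvd_mul_iff_left hp0] at this
        exact this he
      · cases e with
        | zero => simp
        | succ e =>
          rw [pow_succ', mul_dvd_mul_iff_left hp0] at he ⊢
          exact h e he
    · refine forall_congr' fun e => ?_
      have hcop : IsCoprime ((l : ℤ) ^ e) p :=
        (isCoprime_of_prime_ne hp (hB l hl) (Ne.symm hlp)).pow_left
      have hiff : ∀ a : ℤ, (l : ℤ) ^ e ∣ p * a ↔ (l : ℤ) ^ e ∣ a := fun a =>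
        ⟨fun h => hcop.dvd_of_dvd_mul_left h, fun h => h.mul_left _⟩
      rw [hiff, hiff]

theorem mem_localPairs_insert_iff {A B : Finset ℕ} {p : ℕ} (x : ℤ × ℤ) :
    x ∈ localPairs (insert p A) B ↔ x ∈ localPairs A (insert p B) ∧ x ∉ range (scalePair p) := by
  constructor
  · rintro ⟨h0, hA, hB⟩
    have hp := hA p (Finset.mem_insert_self _ _)
    refine ⟨⟨h0, fun l hl => hA l (Finset.mem_insert_of_mem hl), fun l hl => ?_⟩, ?_⟩
    · rcases Finset.mem_insert.1 hl with rfl | hl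
      · intro e he
        cases e with
        | zero => simp
        | succ e => exact absurd ((dvd_pow_self _ e.succ_ne_zero).trans he) hp
      · exact hB l hl
    · rintro ⟨y, rfl⟩
      exact hp (dvd_mul_right _ _)
  · rintro ⟨⟨h0, hA, hB⟩, hr⟩
    refine ⟨h0, fun l hl => ?_, fun l hl => hB l (Finset.mem_insert_of_mem hl)⟩
    rcases Finset.mem_insert.1 hl with rfl | hl
    · intro hdvd
      have h1 := hB l (Finset.mem_insert_self _ _) 1
      rw [pow_one] at h1
      obtain ⟨a, ha⟩ := h1 hdvd
      obtain ⟨b, hb⟩ := hdvd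
      exact hr ⟨(a, b), Prod.ext ha.symm hb.symm⟩
    · exact hA l hl

variable {q : ℂ} {g : ℤ × ℤ → ℂ}

/-- Under the condition at p, p ∣ n forces p ∣ m. So the pairs with p ∣ n are exactly p times the
whole set and contribute p^{-q} times its sum. -/
theorem tsum_localPairs_insert (hg : ∀ c : ℕ, c ≠ 0 → ∀ x, g (scalePair c x) = (c : ℂ) ^ (-q) * g x)
    (hs : Summable g) {A B : Finset ℕ} (hA : ∀ p ∈ A, p.Prime) (hB : ∀ p ∈ B, p.Prime) {p : ℕ}
    (hp : p.Prime) (hpA : p ∉ A) :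
    (1 - (p : ℂ) ^ (-q)) * ∑' x, indicator (localPairs A (insert p B)) g x =
      ∑' x, indicator (localPairs (insert p A) B) g x := by
  set X := localPairs A (insert p B)
  have hX : ∀ x, scalePair p x ∈ X ↔ x ∈ X := fun x =>
    scalePair_mem_localPairs_iff hA (by simpa [hp] using hB) hp hpA (Finset.mem_insert_self _ _) x
  have h1 : ∑' x, indicator (range (scalePair p)) (indicator X g) x =
      (p : ℂ) ^ (-q) * ∑' x, indicator X g x := by
    rw [← (scalePair_injective hp.ne_zero).tsum_eq support_indicator_subset, ← tsum_mul_left]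
    refine tsum_congr fun x => ?_
    rw [indicator_of_mem (mem_range_self x)]
    by_cases hx : x ∈ X
    · rw [indicator_of_mem ((hX x).2 hx), indicator_of_mem hx, hg p hp.ne_zero]
    · rw [indicator_of_notMem (fun h => hx ((hX x).1 h)), indicator_of_notMem hx, mul_zero]
  have h2 : ∀ x, indicator (localPairs (insert p A) B) g x =
      indicator X g x - indicator (range (scalePair p)) (indicator X g) x := by
    intro x
    by_cases hr : x ∈ range (scalePair p)
    · rw [indicator_of_mem hr, sub_self, indicator_of_notMem]
      exact fun h => ((mem_localPairs_insert_iff x).1 h).2 hr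
    · rw [indicator_of_notMem hr, sub_zero]
      by_cases hx : x ∈ X
      · rw [indicator_of_mem hx, indicator_of_mem ((mem_localPairs_insert_iff x).2 ⟨hx, hr⟩)]
      · rw [indicator_of_notMem hx,
          indicator_of_notMem (fun h => hx ((mem_localPairs_insert_iff x).1 h).1)]
  rw [tsum_congr h2, (hs.indicator _).tsum_sub ((hs.indicator _).indicator _), h1]
  ring

/-- Moves the primes from B to A one at a time, each costing an Euler factor. -/
theorem tsum_localPairs (hg : ∀ c : ℕ, c ≠ 0 → ∀ x, g (scalePair c x) = (c : ℂ) ^ (-q) * g x)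
    (hs : Summable g) (B : Finset ℕ) (hB : ∀ p ∈ B, p.Prime) :
    ∀ A : Finset ℕ, (∀ p ∈ A, p.Prime) → Disjoint A B →
    (∏ p ∈ B, (1 - (p : ℂ) ^ (-q))) * ∑' x, indicator (localPairs A B) g x =
      ∑' x, indicator (localPairs (A ∪ B) ∅) g x := by
  induction B using Finset.induction_on with
  | empty => intro A _ _; simp
  | insert p B hpB ih =>
    intro A hA hdisj
    have hp := hB p (Finset.mem_insert_self _ _)
    have hB' : ∀ l ∈ B, l.Prime := fun l hl => hB l (Finset.mem_insert_of_mem hl)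
    rw [Finset.disjoint_insert_right] at hdisj
    rw [Finset.prod_insert hpB, mul_comm (1 - (p : ℂ) ^ (-q)), mul_assoc,
      tsum_localPairs_insert hg hs hA hB' hp hdisj.1,
      ih hB' (insert p A) (by simpa [hp] using hA)
        (Finset.disjoint_insert_left.2 ⟨hpB, hdisj.2⟩), Finset.insert_union, Finset.union_insert]

theorem prod_primes_dvd_iff {T : Finset ℕ} (hT : ∀ p ∈ T, p.Prime) (n : ℤ) :
    ((∏ p ∈ T, p : ℕ) : ℤ) ∣ n ↔ ∀ p ∈ T, (p : ℤ) ∣ n := by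
  constructor
  · intro h p hp
    exact (Int.natCast_dvd_natCast.2 (Finset.dvd_prod_of_mem _ hp)).trans h
  · intro h
    rw [Nat.cast_prod]
    refine Finset.prod_dvd_of_coprime (fun p hp l hl hne => ?_) h
    exact isCoprime_of_prime_ne (hT l hl) (hT p hp) hne.symm

/-- A sum of a homogeneous function over `pairsL N` in terms of sums over lattices. -/
theorem tsum_pairsL {N : ℕ} (hN : N ≠ 0) (h0 : g 0 = 0)
    (hg : ∀ c : ℕ, c ≠ 0 → ∀ x, g (scalePair c x) = (c : ℂ) ^ (-q) * g x) (hs : Summable g) :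
    (∏ p ∈ N.primeFactors, (1 - (p : ℂ) ^ (-q))) * ∑' x : pairsL N, g x =
      ∑ T ∈ N.primeFactors.powerset, (-1) ^ T.card *
        ∑' x : ℤ × ℤ, g (x.1, (∏ p ∈ T, p : ℕ) * x.2) := by
  classical
  set P := N.primeFactors
  have hP : ∀ p ∈ P, p.Prime := fun p hp => Nat.prime_of_mem_primeFactors hp
  have hset : pairsL N = localPairs ∅ P := by
    ext x
    rw [mem_pairsL_iff hN]
    simp [localPairs, P]
  rw [tsum_subtype (pairsL N) g, hset, tsum_localPairs hg hs P hP ∅ (by simp) (by simp),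
    Finset.empty_union]
  -- Inclusion-exclusion: expand ∏_{p ∈ P} (1 - [p ∣ n]) over subsets T.
  have hpt : ∀ x : ℤ × ℤ, indicator (localPairs P ∅) g x = ∑ T ∈ P.powerset,
      (-1 : ℂ) ^ T.card * indicator {x : ℤ × ℤ | ((∏ p ∈ T, p : ℕ) : ℤ) ∣ x.2} g x := by
    intro x
    have hprod := Finset.prod_add (fun p : ℕ => -(if (p : ℤ) ∣ x.2 then (1 : ℂ) else 0))
      (fun _ => 1) P
    have hT : ∀ T ∈ P.powerset, (-1 : ℂ) ^ T.card *
        indicator {x : ℤ × ℤ | ((∏ p ∈ T, p : ℕ) : ℤ) ∣ x.2} g x =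
        (∏ p ∈ T, -(if (p : ℤ) ∣ x.2 then (1 : ℂ) else 0)) * (∏ p ∈ P \ T, 1) * g x := by
      intro T hT
      have hT' : ∀ p ∈ T, p.Prime := fun p hp => hP p (Finset.mem_powerset.1 hT hp)
      rw [Finset.prod_neg, Finset.prod_const_one, mul_one, Finset.prod_ite_zero,
        Finset.prod_const_one]
      by_cases h : ∀ p ∈ T, (p : ℤ) ∣ x.2
      · rw [if_pos h, mul_one,
          indicator_of_mem (show x ∈ {x : ℤ × ℤ | ((∏ p ∈ T, p : ℕ) : ℤ) ∣ x.2} from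
            (prod_primes_dvd_iff hT' _).2 h)]
      · rw [if_neg h,
          indicator_of_notMem (show x ∉ {x : ℤ × ℤ | ((∏ p ∈ T, p : ℕ) : ℤ) ∣ x.2} from
            fun hx => h ((prod_primes_dvd_iff hT' _).1 hx))]
        ring
    rw [Finset.sum_congr rfl hT, ← Finset.sum_mul, ← hprod]
    -- The origin is missing from `localPairs` but present in the lattice sums; `g 0 = 0` makes this
    -- harmless.
    by_cases hx : x = 0
    · rw [hx, h0, mul_zero]
      exact indicator_of_notMem (fun h => h.1 rfl) g
    by_cases hall : ∀ p ∈ P, ¬ (p : ℤ) ∣ x.2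
    · rw [indicator_of_mem (show x ∈ localPairs P ∅ from ⟨hx, hall, by simp⟩), Finset.prod_congr rfl (g := fun _ => (1 : ℂ)),
        Finset.prod_const_one, one_mul]
      intro p hp
      simp [hall p hp]
    · rw [indicator_of_notMem (fun h => hall h.2.1)]
      push Not at hall
      obtain ⟨p, hp, hdvd⟩ := hall
      rw [Finset.prod_eq_zero hp (by simp [hdvd]), zero_mul]
  rw [tsum_congr hpt, Summable.tsum_finsetSum fun T _ => (hs.indicator _).mul_left _]
  refine Finset.sum_congr rfl fun T hT => ?_
  rw [tsum_mul_left]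
  congr 1
  have hne : ((∏ p ∈ T, p : ℕ) : ℤ) ≠ 0 := by
    exact_mod_cast Finset.prod_ne_zero_iff.2 fun p hp =>
      (hP p (Finset.mem_powerset.1 hT hp)).ne_zero
  have hinj : Function.Injective fun x : ℤ × ℤ => (x.1, ((∏ p ∈ T, p : ℕ) : ℤ) * x.2) := by
    intro x y h
    simp only [Prod.mk.injEq] at h
    exact Prod.ext h.1 (mul_left_cancel₀ hne h.2)
  rw [← hinj.tsum_eq]
  · exact tsum_congr fun x => indicator_of_mem (by exact dvd_mul_right _ _) g
  · refine support_indicator_subset.trans ?_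
    rintro ⟨m, n⟩ ⟨l, hl⟩
    exact ⟨(m, l), Prod.ext rfl hl.symm⟩

end

/-! ### Local factors -/

/-- The geometric sum `∑_{a < v} p^{aν}`. -/
noncomputable def geomFactor (p : ℕ) (ν : ℂ) (v : ℕ) : ℂ := ∑ a ∈ Finset.range v, ((p : ℂ) ^ ν) ^ a

theorem geomFactor_succ (p : ℕ) (ν : ℂ) (v : ℕ) :
    geomFactor p ν (v + 1) = geomFactor p ν v + ((p : ℂ) ^ ν) ^ v :=
  Finset.sum_range_succ _ _

theorem geomFactor_succ' (p : ℕ) (ν : ℂ) (v : ℕ) :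
    geomFactor p ν (v + 1) = 1 + (p : ℂ) ^ ν * geomFactor p ν v := by
  rw [geomFactor, Finset.sum_range_succ', geomFactor, Finset.mul_sum, add_comm, pow_zero]
  congr 1
  exact Finset.sum_congr rfl fun a _ => pow_succ' _ _

theorem norm_prime_cpow_lt_one {p : ℕ} (hp : p.Prime) {ν : ℂ} (hν : ν.re < 0) :
    ‖(p : ℂ) ^ ν‖ < 1 := by
  rw [norm_natCast_cpow_of_pos hp.pos]
  exact Real.rpow_lt_one_of_one_lt_of_neg (by exact_mod_cast hp.one_lt) hν

theorem one_sub_prime_cpow_ne_zero {p : ℕ} (hp : p.Prime) {ν : ℂ} (hν : ν.re < 0) :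
    1 - (p : ℂ) ^ ν ≠ 0 := by
  intro h
  have := norm_prime_cpow_lt_one hp hν
  rw [← sub_eq_zero.1 h] at this
  simp at this

/-- With x = p^ν the sum times x - 1 is x^{v+1} - 1, nonzero since |x| < 1. -/
theorem geomFactor_succ_ne_zero {p : ℕ} (hp : p.Prime) {ν : ℂ} (hν : ν.re < 0) (v : ℕ) :
    geomFactor p ν (v + 1) ≠ 0 := by
  intro h
  have h1 := geom_sum_mul ((p : ℂ) ^ ν) (v + 1)
  rw [geomFactor] at h
  rw [h, zero_mul] at h1
  have h2 := congrArg norm (sub_eq_zero.1 h1.symm)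
  rw [norm_pow, norm_one] at h2
  exact absurd h2 (pow_lt_one₀ (norm_nonneg _) (norm_prime_cpow_lt_one hp hν) v.succ_ne_zero).ne

theorem sum_divisors_cpow_mul {m n : ℕ} (h : m.Coprime n) (ν : ℂ) :
    ∑ d ∈ (m * n).divisors, (d : ℂ) ^ ν =
      (∑ d ∈ m.divisors, (d : ℂ) ^ ν) * ∑ d ∈ n.divisors, (d : ℂ) ^ ν := by
  rw [h.divisors_mul, Finset.sum_map, Finset.sum_mul_sum, ← Finset.sum_product',
    ← Finset.sum_attach (m.divisors ×ˢ n.divisors)]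
  refine Finset.sum_congr rfl fun d _ => ?_
  change ((d.1.1 * d.1.2 : ℕ) : ℂ) ^ ν = _
  rw [Nat.cast_mul, natCast_mul_natCast_cpow]

theorem sum_divisors_prime_pow_mul {p : ℕ} (hp : p.Prime) (v : ℕ) {m : ℕ} (hm : ¬ p ∣ m) (ν : ℂ) :
    ∑ d ∈ (p ^ v * m).divisors, (d : ℂ) ^ ν =
      geomFactor p ν (v + 1) * ∑ d ∈ m.divisors, (d : ℂ) ^ ν := by
  rw [sum_divisors_cpow_mul (((Nat.Prime.coprime_iff_not_dvd hp).2 hm).pow_left v),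
    Nat.sum_divisors_prime_pow hp]
  congr 1
  refine Finset.sum_congr rfl fun a _ => ?_
  rw [Nat.cast_pow, ← natCast_cpow_natCast_mul, cpow_nat_mul]

/-- The quotient of the local factors of `σ_ν(n/p)` and `σ_ν(n)` at `p`. -/
noncomputable def sigmaRatio (ν : ℂ) (n : ℤ) (p : ℕ) : ℂ :=
  if n = 0 then 1 else
    geomFactor p ν (padicValInt p n) / geomFactor p ν (padicValInt p n + 1)

/-- By multiplicativity σ_ν(l) and σ_ν(pl) differ only in the factor at p. At l = 0 both values are
ζ(-ν), which is why `sigmaRatio` is 1 there. -/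
theorem sigmaExt_prime_mul {p : ℕ} (hp : p.Prime) {ν : ℂ} (hν : ν.re < 0) (l : ℤ) :
    sigmaExt ν (p * l) * sigmaRatio ν (p * l) p = sigmaExt ν l := by
  have : Fact p.Prime := ⟨hp⟩
  have hp0 : (p : ℤ) ≠ 0 := by exact_mod_cast hp.ne_zero
  rcases eq_or_ne l 0 with rfl | hl
  · simp [sigmaExt, sigmaRatio]
  have hpl : (p : ℤ) * l ≠ 0 := mul_ne_zero hp0 hl
  obtain ⟨v, m, hm, hlm⟩ := Nat.exists_eq_pow_mul_and_not_dvd (Int.natAbs_ne_zero.2 hl) p hp.ne_one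
  have hm0 : m ≠ 0 := fun h => hm (h ▸ dvd_zero p)
  have hv : padicValInt p (p * l) = v + 1 := by
    rw [mul_comm, padicValInt_mul_eq_succ l hl, padicValInt, hlm,
      padicValNat.mul (pow_ne_zero _ hp.ne_zero) hm0, padicValNat.prime_pow,
      padicValNat.eq_zero_of_not_dvd hm, add_zero]
  have h1 : ((p : ℤ) * l).natAbs = p ^ (v + 1) * m := by
    rw [Int.natAbs_mul, hlm, Int.natAbs_natCast]
    ring
  rw [sigmaExt, if_neg hpl, sigmaExt, if_neg hl, sigmaRatio, if_neg hpl, hv, sigmaC, sigmaC, h1,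
    hlm, sum_divisors_prime_pow_mul hp _ hm, sum_divisors_prime_pow_mul hp _ hm]
  have := geomFactor_succ_ne_zero hp hν (v + 1)
  field_simp

theorem sigmaRatio_mul_of_ne {ν : ℂ} {D : ℕ} (hD : D ≠ 0) {p : ℕ} (hp : p.Prime) (h : ¬ p ∣ D)
    (l : ℤ) : sigmaRatio ν (D * l) p = sigmaRatio ν l p := by
  have : Fact p.Prime := ⟨hp⟩
  have hD0 : (D : ℤ) ≠ 0 := by exact_mod_cast hD
  rcases eq_or_ne l 0 with rfl | hl
  · simp
  rw [sigmaRatio, sigmaRatio, if_neg hl, if_neg (mul_ne_zero hD0 hl), padicValInt.mul hD0 hl,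
    padicValInt.of_nat, padicValNat.eq_zero_of_not_dvd h, zero_add]

theorem sigmaExt_prod_mul {ν : ℂ} (hν : ν.re < 0) (T : Finset ℕ) (hT : ∀ p ∈ T, p.Prime) :
    ∀ l : ℤ, sigmaExt ν ((∏ p ∈ T, p : ℕ) * l) *
      ∏ p ∈ T, sigmaRatio ν ((∏ p ∈ T, p : ℕ) * l) p = sigmaExt ν l := by
  induction T using Finset.induction_on with
  | empty => simp
  | insert p T hpT ih =>
    intro l
    have hp := hT p (Finset.mem_insert_self _ _)
    have hT' : ∀ l ∈ T, l.Prime := fun l hl => hT l (Finset.mem_insert_of_mem hl)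
    have hD : ∏ l ∈ T, l ≠ 0 := Finset.prod_ne_zero_iff.2 fun l hl => (hT' l hl).ne_zero
    have hnd : ¬ p ∣ ∏ l ∈ T, l := by
      rw [hp.prime.dvd_finsetProd_iff]
      rintro ⟨l, hl, hpl⟩
      exact hpT ((Nat.prime_dvd_prime_iff_eq hp (hT' l hl)).1 hpl ▸ hl)
    have e : ((∏ l ∈ insert p T, l : ℕ) : ℤ) * l = (∏ l ∈ T, l : ℕ) * (p * l) := by
      rw [Finset.prod_insert hpT]
      push_cast
      ring
    rw [e, Finset.prod_insert hpT, mul_left_comm, ih hT', sigmaRatio_mul_of_ne hD hp hnd, mul_comm,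
      sigmaExt_prime_mul hp hν]

/-- If p ∤ n the numerator of the ratio is an empty geometric sum. Hence a series over multiples of
D can be written as a series over all n. -/
theorem prod_sigmaRatio_eq_zero {ν : ℂ} {T : Finset ℕ} (hT : ∀ p ∈ T, p.Prime) {n : ℤ}
    (h : ¬ ((∏ p ∈ T, p : ℕ) : ℤ) ∣ n) : ∏ p ∈ T, sigmaRatio ν n p = 0 := by
  rw [prod_primes_dvd_iff hT] at h
  push Not at h
  obtain ⟨p, hp, hpn⟩ := h
  refine Finset.prod_eq_zero hp ?_
  have hn : n ≠ 0 := fun h0 => hpn (h0 ▸ dvd_zero _)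
  rw [sigmaRatio, if_neg hn, padicValInt.eq_zero_of_not_dvd hpn]
  simp [geomFactor]

/-! ### The factors `f_{N,b}` -/

theorem truncLocalZeta_eq (p : ℕ) (ν : ℂ) (v : ℕ) :
    truncLocalZeta p (-ν) v = geomFactor p ν (v + 1) := by
  refine Finset.sum_congr rfl fun a _ => ?_
  rw [neg_mul_neg, cpow_nat_mul]

/-- With x = p^{1-q} the i-th power in the sum is p^{-1} x^i and the last one is p^{-1} x^{v+1};
then (p - 1)p^{-1} = 1 - p^{-1} splits the sum into the two geometric sums. -/
theorem localNumerator_eq {p : ℕ} (hp : p.Prime) (q : ℂ) (v : ℕ) :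
    ((∑ i ∈ Finset.Icc 1 v, ((p : ℂ) - 1) * (p : ℂ) ^ ((i : ℂ) - 1 + (i : ℂ) * (-q))) -
      (p : ℂ) ^ ((v : ℂ) + ((v : ℂ) + 1) * (-q))) =
    -(p : ℂ) ^ (-q) * geomFactor p (1 - q) (v + 1) +
      (p : ℂ) ^ (1 - q) * geomFactor p (1 - q) v := by
  have hp0 : (p : ℂ) ≠ 0 := by exact_mod_cast hp.ne_zero
  set x : ℂ := (p : ℂ) ^ (1 - q) with hx
  have hpow : ∀ i : ℕ, (p : ℂ) ^ ((i : ℂ) - 1 + (i : ℂ) * (-q)) = (p : ℂ)⁻¹ * x ^ i := by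
    intro i
    rw [hx, ← cpow_nat_mul, ← cpow_neg_one, ← cpow_add _ _ hp0]
    ring_nf
  have h1 : (p : ℂ) ^ ((v : ℂ) + ((v : ℂ) + 1) * (-q)) = (p : ℂ)⁻¹ * x ^ (v + 1) := by
    rw [← hpow]
    push_cast
    ring_nf
  have h2 : (p : ℂ) ^ (-q) = (p : ℂ)⁻¹ * x := by
    have := hpow 1
    rw [pow_one] at this
    rw [← this]
    push_cast
    ring_nf
  have h3 : ∑ i ∈ Finset.Icc 1 v, x ^ i = x * geomFactor p (1 - q) v := by
    clear h1
    induction v with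
    | zero => simp [geomFactor]
    | succ v ih =>
      rw [Finset.sum_Icc_succ_top (by omega), ih, geomFactor_succ]
      ring
  simp only [hpow]
  rw [h1, h2, ← Finset.mul_sum, ← Finset.mul_sum, h3, geomFactor_succ]
  rw [← hx, pow_succ]
  field_simp
  ring

/-- The reflection s ↦ 1 - k - s turns 2s + k - 2 into -q, so all local factors become expressions
in p^{-q} and p^{1-q}. -/
theorem fFactor_reflect {N : ℕ} (k : ℤ) (s : ℂ) (b : ℤ) :
    fFactor N k b (1 - k - s) =
      ((N : ℂ) ^ ((2 * s + k) / 2) * ∏ p ∈ N.primeFactors,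
        (-(p : ℂ) ^ (-(2 * s + k)) * geomFactor p (1 - (2 * s + k)) (padicValInt p b + 1) +
          (p : ℂ) ^ (1 - (2 * s + k)) * geomFactor p (1 - (2 * s + k)) (padicValInt p b)) + 1) /
      ∏ p ∈ N.primeFactors, ((1 - (p : ℂ) ^ (-(2 * s + k))) *
        geomFactor p (1 - (2 * s + k)) (padicValInt p b + 1)) := by
  have e1 : -((1 - k - s) - 1) - (k : ℂ) / 2 = (2 * s + k) / 2 := by ring
  have e2 : 2 * (1 - k - s) + (k : ℂ) - 2 = -(2 * s + k) := by ring
  have e3 : -2 * (1 - k - s) - (k : ℂ) + 2 = 2 * s + k := by ring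
  have e4 : -2 * (1 - k - s) - (k : ℂ) + 1 = -(1 - (2 * s + k)) := by ring
  rw [fFactor, e1, e2, e3, e4]
  congr 1
  · congr 2
    exact Finset.prod_congr rfl fun p hp =>
      localNumerator_eq (Nat.prime_of_mem_primeFactors hp) _ _
  · refine Finset.prod_congr rfl fun p hp => ?_
    rw [localZeta, inv_inv, truncLocalZeta_eq]

section

/-! ### The Eisenstein series as a combination of lattice sums -/

/-- The point `cz` of the upper half plane, for `c > 0`. -/
noncomputable def scaleUHP {c : ℝ} (hc : 0 < c) (z : UpperHalfPlane) : UpperHalfPlane :=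
  ⟨c * z, by
    rw [im_ofReal_mul]
    exact mul_pos hc z.im_pos⟩

theorem coe_scaleUHP {c : ℝ} (hc : 0 < c) (z : UpperHalfPlane) :
    (scaleUHP hc z : ℂ) = c * z := rfl

theorem scaleUHP_im {c : ℝ} (hc : 0 < c) (z : UpperHalfPlane) :
    (scaleUHP hc z).im = c * z.im := by
  rw [← UpperHalfPlane.coe_im, coe_scaleUHP, im_ofReal_mul, UpperHalfPlane.coe_im]

theorem scaleUHP_re {c : ℝ} (hc : 0 < c) (z : UpperHalfPlane) :
    (scaleUHP hc z).re = c * z.re := by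
  rw [← UpperHalfPlane.coe_re, coe_scaleUHP, re_ofReal_mul, UpperHalfPlane.coe_re]

variable {N : ℕ} {k : ℤ} {s : ℂ}

theorem prod_primes_pos {T : Finset ℕ} (hT : T ⊆ N.primeFactors) : 0 < ∏ p ∈ T, p :=
  Finset.prod_pos fun _ hp => (Nat.prime_of_mem_primeFactors (hT hp)).pos

theorem summable_eisPhi_left (hN : N ≠ 0) (hq : 2 < (2 * s + k).re) (z : UpperHalfPlane) :
    Summable fun x : ℤ × ℤ => eisPhi k s (((√(N : ℝ) : ℝ) : ℂ) * x.1 * z + x.2) := by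
  have hr : 0 < √(N : ℝ) := Real.sqrt_pos.2 (by exact_mod_cast Nat.pos_of_ne_zero hN)
  refine (summable_eisPhi_lattice hq (scaleUHP hr z)).congr fun x => ?_
  rw [coe_scaleUHP]
  ring_nf

theorem summable_eisPhi_right (hN : N ≠ 0) (hq : 2 < (2 * s + k).re) (z : UpperHalfPlane) :
    Summable fun x : ℤ × ℤ => eisPhi k s ((x.1 : ℂ) * z + ((√(N : ℝ) : ℝ) : ℂ) * x.2) := by
  have hr : 0 < √(N : ℝ) := Real.sqrt_pos.2 (by exact_mod_cast Nat.pos_of_ne_zero hN)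
  have hr' : ((√(N : ℝ) : ℝ) : ℂ) ≠ 0 := ofReal_ne_zero.2 hr.ne'
  refine ((summable_eisPhi_lattice hq (scaleUHP (inv_pos.2 hr) z)).mul_left
    (((√(N : ℝ) : ℝ) : ℂ) ^ (-(2 * s + k)))).congr fun x => ?_
  rw [← eisPhi_ofReal_mul _ _ _ hr, coe_scaleUHP, ofReal_inv]
  congr 1
  field_simp

/-- Homogeneity applied to √N m z + D n = D (m (√N/D) z + n). -/
theorem tsum_eisPhi_pairsL (hN : N ≠ 0) (hq : 2 < (2 * s + k).re) (z : UpperHalfPlane)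
    (τ : Finset ℕ → UpperHalfPlane)
    (hτ : ∀ T ⊆ N.primeFactors, (τ T : ℂ) = (√(N : ℝ) / (∏ p ∈ T, p : ℕ) : ℝ) * z) :
    (∏ p ∈ N.primeFactors, (1 - (p : ℂ) ^ (-(2 * s + k)))) *
      ∑' x : pairsL N, eisPhi k s (((√(N : ℝ) : ℝ) : ℂ) * x.1.1 * z + x.1.2) =
    ∑ T ∈ N.primeFactors.powerset, (-1) ^ T.card *
      (((∏ p ∈ T, p : ℕ) : ℂ) ^ (-(2 * s + k)) * latticeSum k s (τ T)) := by
  rw [tsum_pairsL (g := fun x : ℤ × ℤ => eisPhi k s (((√(N : ℝ) : ℝ) : ℂ) * x.1 * z + x.2)) hN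
    (by simpa using eisPhi_zero hq) (fun c hc x => ?_) (summable_eisPhi_left hN hq z)]
  · refine Finset.sum_congr rfl fun T hT => ?_
    have hD : (0 : ℝ) < (∏ p ∈ T, p : ℕ) := by
      exact_mod_cast prod_primes_pos (Finset.mem_powerset.1 hT)
    have hD' : ((∏ p ∈ T, p : ℕ) : ℂ) ≠ 0 := by exact_mod_cast hD.ne'
    congr 1
    rw [latticeSum, ← tsum_mul_left]
    refine tsum_congr fun x => ?_
    rw [hτ T (Finset.mem_powerset.1 hT), ← ofReal_natCast, ← eisPhi_ofReal_mul _ _ _ hD]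
    congr 1
    push_cast at hD' ⊢
    field_simp
  · have hc' : (0 : ℝ) < c := by exact_mod_cast Nat.pos_of_ne_zero hc
    simp only [scalePair]
    rw [← ofReal_natCast, ← eisPhi_ofReal_mul _ _ _ hc']
    congr 1
    push_cast
    ring

/-- Swapping coordinates reduces to `pairsL`. Now D multiplies m, and D m z + √N n = √N (m (D/√N) z
+ n), so the scalar pulled out does not depend on T. -/
theorem tsum_eisPhi_pairsR (hN : N ≠ 0) (hq : 2 < (2 * s + k).re) (z : UpperHalfPlane)
    (τ : Finset ℕ → UpperHalfPlane)
    (hτ : ∀ T ⊆ N.primeFactors, (τ T : ℂ) = ((∏ p ∈ T, p : ℕ) / √(N : ℝ) : ℝ) * z) :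
    (∏ p ∈ N.primeFactors, (1 - (p : ℂ) ^ (-(2 * s + k)))) *
      ∑' x : pairsR N, eisPhi k s ((x.1.1 : ℂ) * z + ((√(N : ℝ) : ℝ) : ℂ) * x.1.2) =
    ∑ T ∈ N.primeFactors.powerset, (-1) ^ T.card *
      (((√(N : ℝ) : ℝ) : ℂ) ^ (-(2 * s + k)) * latticeSum k s (τ T)) := by
  have hr : 0 < √(N : ℝ) := Real.sqrt_pos.2 (by exact_mod_cast Nat.pos_of_ne_zero hN)
  have hr' : ((√(N : ℝ) : ℝ) : ℂ) ≠ 0 := ofReal_ne_zero.2 hr.ne'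
  let e : pairsR N ≃ pairsL N :=
    (Equiv.prodComm ℤ ℤ).subtypeEquiv fun x => (swap_mem_pairsL_iff N x).symm
  have he : ∑' x : pairsR N, eisPhi k s ((x.1.1 : ℂ) * z + ((√(N : ℝ) : ℝ) : ℂ) * x.1.2) =
      ∑' x : pairsL N, eisPhi k s ((x.1.2 : ℂ) * z + ((√(N : ℝ) : ℝ) : ℂ) * x.1.1) := by
    rw [← e.tsum_eq]
    rfl
  have hs : Summable fun x : ℤ × ℤ =>
      eisPhi k s ((x.2 : ℂ) * z + ((√(N : ℝ) : ℝ) : ℂ) * x.1) :=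
    (Equiv.prodComm ℤ ℤ).summable_iff.2 (summable_eisPhi_right hN hq z)
  rw [he, tsum_pairsL (g := fun x : ℤ × ℤ =>
    eisPhi k s ((x.2 : ℂ) * z + ((√(N : ℝ) : ℝ) : ℂ) * x.1)) hN
    (by simpa using eisPhi_zero hq) (fun c hc x => ?_) hs]
  · refine Finset.sum_congr rfl fun T hT => ?_
    congr 1
    rw [latticeSum, ← tsum_mul_left, ← (Equiv.prodComm ℤ ℤ).tsum_eq]
    refine tsum_congr fun x => ?_
    rw [hτ T (Finset.mem_powerset.1 hT), ← eisPhi_ofReal_mul _ _ _ hr]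
    congr 1
    simp only [Equiv.prodComm_apply, Prod.fst_swap, Prod.snd_swap]
    push_cast
    field_simp
  · have hc' : (0 : ℝ) < c := by exact_mod_cast Nat.pos_of_ne_zero hc
    simp only [scalePair]
    rw [← ofReal_natCast, ← eisPhi_ofReal_mul _ _ _ hc']
    congr 1
    push_cast
    ring

theorem natCast_prod_cpow (T : Finset ℕ) (a : ℂ) :
    ((∏ p ∈ T, p : ℕ) : ℂ) ^ a = ∏ p ∈ T, (p : ℂ) ^ a := by
  induction T using Finset.induction_on with
  | empty => simp
  | insert p T hp ih =>
    rw [Finset.prod_insert hp, Finset.prod_insert hp, Nat.cast_mul, natCast_mul_natCast_cpow, ih]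

/-- The Fourier expansion of a lattice sum at `Dz/√N`, with frequencies in `ℤ/√N`. -/
theorem hasSum_latticeSum_scaled (hN : N ≠ 0) (hk : Even k) (hq : 2 < (2 * s + k).re)
    (z : UpperHalfPlane) {T : Finset ℕ} (hT : T ⊆ N.primeFactors) {τ : UpperHalfPlane}
    (hτ : (τ : ℂ) = ((∏ p ∈ T, p : ℕ) / √(N : ℝ) : ℝ) * z) :
    HasSum (fun n : ℤ => sigmaExt (1 - (2 * s + k)) n *
        ((∏ p ∈ T, (p : ℂ) ^ (1 - (2 * s + k)) * sigmaRatio (1 - (2 * s + k)) n p) *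
        (((√(N : ℝ) : ℝ) : ℂ) ^ (2 * s + k - 1) * ((-1 : ℂ) ^ (k / 2) *
          fourierTerm (s + k) s z.im z.re (n / √(N : ℝ))))))
      (latticeSum k s τ / 2 - riemannZeta (2 * s + k)) := by
  have hr : 0 < √(N : ℝ) := Real.sqrt_pos.2 (by exact_mod_cast Nat.pos_of_ne_zero hN)
  have hr' : ((√(N : ℝ) : ℝ) : ℂ) ≠ 0 := ofReal_ne_zero.2 hr.ne'
  have hT' : ∀ p ∈ T, p.Prime := fun p hp => Nat.prime_of_mem_primeFactors (hT hp)
  set D := ∏ p ∈ T, p with hDdef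
  have hD : (0 : ℝ) < D := by exact_mod_cast prod_primes_pos hT
  have hD0 : (D : ℤ) ≠ 0 := by exact_mod_cast hD.ne'
  have hc : 0 < (D : ℝ) / √(N : ℝ) := div_pos hD hr
  have hν : (1 - (2 * s + k)).re < 0 := by rw [sub_re, one_re]; linarith
  have hτ' : τ = scaleUHP hc z := UpperHalfPlane.ext hτ
  have key := hasSum_latticeSum hk hq (scaleUHP hc z)
  rw [← hτ'] at key
  -- Reindex by n = Dl; outside the multiples of D the summand vanishes through a local ratio.
  have hinj : Function.Injective fun l : ℤ => (D : ℤ) * l := fun a b h => mul_left_cancel₀ hD0 h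
  rw [← hinj.hasSum_iff]
  · refine key.congr_fun fun l => ?_
    simp only [Function.comp_apply]
    rw [hτ', scaleUHP_im, scaleUHP_re, fourierTerm_mul _ _ hc, Finset.prod_mul_distrib,
      ← natCast_prod_cpow, ← hDdef, ← sigmaExt_prod_mul hν T hT' l, ← hDdef]
    have h1 : ((D / √(N : ℝ) : ℝ) : ℂ) ^ (1 - (s + k) - s) =
        (D : ℂ) ^ (1 - (2 * s + k)) * ((√(N : ℝ) : ℝ) : ℂ) ^ (2 * s + k - 1) := by
      rw [div_eq_mul_inv, ofReal_mul, ofReal_mul_cpow hD, ofReal_natCast,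
        show 1 - (s + (k : ℂ)) - s = 1 - (2 * s + k) by ring,
        show 2 * s + (k : ℂ) - 1 = -(1 - (2 * s + k)) by ring, cpow_neg, ofReal_inv, inv_cpow]
      rw [arg_ofReal_of_nonneg hr.le]
      exact Real.pi_pos.ne
    have h2 : (D : ℝ) / √(N : ℝ) * (l : ℝ) = (((D : ℤ) * l : ℤ) : ℝ) / √(N : ℝ) := by
      push_cast
      ring
    rw [h1, h2]
    ring
  · intro n hn
    have hnd : ¬ ((∏ p ∈ T, p : ℕ) : ℤ) ∣ n := by
      rintro ⟨l, rfl⟩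
      exact hn ⟨l, rfl⟩
    rw [Finset.prod_mul_distrib, prod_sigmaRatio_eq_zero hT' hnd]
    ring

/-- The combination of local factors in the Fourier coefficients. -/
noncomputable def localCoeff (N : ℕ) (q : ℂ) (n : ℤ) : ℂ :=
  ∏ p ∈ N.primeFactors, ((p : ℂ) ^ (1 - q) * sigmaRatio (1 - q) n p + -(p : ℂ) ^ (-q)) +
    ((√(N : ℝ) : ℝ) : ℂ) ^ (-q) *
      ∏ p ∈ N.primeFactors, (-((p : ℂ) ^ (1 - q) * sigmaRatio (1 - q) n p) + 1)

/-- Both series involve the same lattice sums at D_T z/√N. The coefficient is ∏_{p ∈ P \ T}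
(-p^{-q}) from the left series and (-1)^{|T|} √N^{-q} from the right one. The local ratios are
products over T, so the sums over T are expanded products, one for each term of `localCoeff`. -/
theorem hasSum_eisenstein (hN : 1 < N) (hsq : Squarefree N) (hk : Even k)
    (hq : 2 < (2 * s + k).re) (z : UpperHalfPlane) :
    HasSum (fun n : ℤ => sigmaExt (1 - (2 * s + k)) n *
        (localCoeff N (2 * s + k) n *
        (((√(N : ℝ) : ℝ) : ℂ) ^ (2 * s + k - 1) * ((-1 : ℂ) ^ (k / 2) *
          fourierTerm (s + k) s z.im z.re (n / √(N : ℝ))))))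
      ((∏ p ∈ N.primeFactors, (1 - (p : ℂ) ^ (-(2 * s + k)))) *
        ((∑' x : pairsL N, eisPhi k s (((√(N : ℝ) : ℝ) : ℂ) * x.1.1 * z + x.1.2) +
          ∑' x : pairsR N, eisPhi k s ((x.1.1 : ℂ) * z + ((√(N : ℝ) : ℝ) : ℂ) * x.1.2)) / 2 -
        riemannZeta (2 * s + k))) := by
  classical
  have hN0 : N ≠ 0 := by omega
  have hNpos : (0 : ℝ) < N := by exact_mod_cast Nat.pos_of_ne_zero hN0
  have hr : 0 < √(N : ℝ) := Real.sqrt_pos.2 hNpos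
  set P := N.primeFactors with hP
  have hPne : P.Nonempty := Nat.nonempty_primeFactors.2 hN
  set q : ℂ := 2 * s + k with hqdef
  have hprodpos : ∀ T, T ⊆ P → (0 : ℝ) < (∏ p ∈ T, p : ℕ) := fun T hT => by
    exact_mod_cast prod_primes_pos (N := N) hT
  set τ : Finset ℕ → UpperHalfPlane := fun T =>
    if hT : T ⊆ P then scaleUHP (div_pos (hprodpos T hT) hr) z else z with hτdef
  have hτ : ∀ T ⊆ P, (τ T : ℂ) = ((∏ p ∈ T, p : ℕ) / √(N : ℝ) : ℝ) * z := fun T hT => by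
    simp only [hτdef, dif_pos hT]
    rfl
  -- As N is squarefree, N/D_T is the product over the complement of T; so the left series uses the
  -- same points after T ↦ P \ T.
  have hcompl : ∀ T ⊆ P, √(N : ℝ) / (∏ p ∈ T, p : ℕ) = (∏ p ∈ P \ T, p : ℕ) / √(N : ℝ) := by
    intro T hT
    have h1 : (∏ p ∈ P \ T, p) * ∏ p ∈ T, p = N := by
      rw [Finset.prod_sdiff hT, hP, Nat.prod_primeFactors_of_squarefree hsq]
    rw [div_eq_div_iff (hprodpos T hT).ne' hr.ne', Real.mul_self_sqrt hNpos.le, ← Nat.cast_mul, h1]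
  have hL := tsum_eisPhi_pairsL (k := k) hN0 hq z (fun T => τ (P \ T)) (fun T hT => by
    rw [hτ _ Finset.sdiff_subset, hcompl T hT])
  have hR := tsum_eisPhi_pairsR (k := k) hN0 hq z τ hτ
  have hL' : ∑ T ∈ P.powerset, (-1 : ℂ) ^ T.card *
      (((∏ p ∈ T, p : ℕ) : ℂ) ^ (-q) * latticeSum k s (τ (P \ T))) =
      ∑ T ∈ P.powerset, (∏ p ∈ P \ T, -(p : ℂ) ^ (-q)) * latticeSum k s (τ T) := by
    refine Finset.sum_nbij' (fun T => P \ T) (fun T => P \ T) ?_ ?_ ?_ ?_ ?_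
    · exact fun T _ => Finset.mem_powerset.2 Finset.sdiff_subset
    · exact fun T _ => Finset.mem_powerset.2 Finset.sdiff_subset
    · exact fun T hT => Finset.sdiff_sdiff_eq_self (Finset.mem_powerset.1 hT)
    · exact fun T hT => Finset.sdiff_sdiff_eq_self (Finset.mem_powerset.1 hT)
    · intro T hT
      rw [Finset.sdiff_sdiff_eq_self (Finset.mem_powerset.1 hT), Finset.prod_neg,
        natCast_prod_cpow, mul_assoc]
  rw [← hqdef, ← hP] at hL hR
  rw [hL'] at hL
  have hsum1 : ∑ T ∈ P.powerset, ∏ p ∈ P \ T, -(p : ℂ) ^ (-q) = ∏ p ∈ P, (1 - (p : ℂ) ^ (-q)) := by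
    have := Finset.prod_add (fun _ : ℕ => (1 : ℂ)) (fun p : ℕ => -(p : ℂ) ^ (-q)) P
    simp only [Finset.prod_const_one, one_mul] at this
    rw [← this]
    exact Finset.prod_congr rfl fun p _ => (sub_eq_add_neg _ _).symm
  -- The terms ζ(q) coming from the right series cancel, since (-1 + 1)^{|P|} = 0 for N > 1.
  have hsum2 : ∑ T ∈ P.powerset, (-1 : ℂ) ^ T.card = 0 := by
    have := Finset.prod_add (fun _ : ℕ => (-1 : ℂ)) (fun _ : ℕ => 1) P
    simp only [Finset.prod_const_one, mul_one, Finset.prod_const, neg_add_cancel] at this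
    rw [← this, zero_pow hPne.card_ne_zero]
  have key := hasSum_sum (s := P.powerset) fun T hT =>
    (hasSum_latticeSum_scaled hN0 hk hq z (Finset.mem_powerset.1 hT)
      (hτ T (Finset.mem_powerset.1 hT))).mul_left
      (∏ p ∈ P \ T, -(p : ℂ) ^ (-q) + (-1 : ℂ) ^ T.card * ((√(N : ℝ) : ℝ) : ℂ) ^ (-q))
  have hval : (∏ p ∈ P, (1 - (p : ℂ) ^ (-q))) *
        ((∑' x : pairsL N, eisPhi k s (((√(N : ℝ) : ℝ) : ℂ) * x.1.1 * z + x.1.2) +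
          ∑' x : pairsR N, eisPhi k s ((x.1.1 : ℂ) * z + ((√(N : ℝ) : ℝ) : ℂ) * x.1.2)) / 2 -
        riemannZeta q) = ∑ T ∈ P.powerset,
      (∏ p ∈ P \ T, -(p : ℂ) ^ (-q) + (-1 : ℂ) ^ T.card * ((√(N : ℝ) : ℝ) : ℂ) ^ (-q)) *
        (latticeSum k s (τ T) / 2 - riemannZeta (2 * s + k)) := by
    rw [mul_sub, mul_div_assoc', mul_add, hL, hR, ← hsum1, ← Finset.sum_add_distrib,
      Finset.sum_div]
    have e : ∀ T ∈ P.powerset, (∏ p ∈ P \ T, -(p : ℂ) ^ (-q) +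
        (-1 : ℂ) ^ T.card * ((√(N : ℝ) : ℝ) : ℂ) ^ (-q)) *
        (latticeSum k s (τ T) / 2 - riemannZeta (2 * s + k)) =
        ((∏ p ∈ P \ T, -(p : ℂ) ^ (-q)) * latticeSum k s (τ T) +
          (-1) ^ T.card * (((√(N : ℝ) : ℝ) : ℂ) ^ (-q) * latticeSum k s (τ T))) / 2 -
        (∏ p ∈ P \ T, -(p : ℂ) ^ (-q)) * riemannZeta q -
        (-1) ^ T.card * (((√(N : ℝ) : ℝ) : ℂ) ^ (-q) * riemannZeta q) := fun T _ => by
      rw [hqdef]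
      ring
    rw [Finset.sum_congr rfl e, Finset.sum_sub_distrib, Finset.sum_sub_distrib, ← Finset.sum_mul,
      ← Finset.sum_mul, hsum2, zero_mul, sub_zero]
  rw [hval]
  refine key.congr_fun fun n => ?_
  have h1 := Finset.prod_add
    (fun p : ℕ => (p : ℂ) ^ (1 - q) * sigmaRatio (1 - q) n p) (fun p : ℕ => -(p : ℂ) ^ (-q)) P
  have h2 := Finset.prod_add
    (fun p : ℕ => -((p : ℂ) ^ (1 - q) * sigmaRatio (1 - q) n p)) (fun _ : ℕ => 1) P
  rw [localCoeff, ← hP, h1, h2, Finset.mul_sum, ← Finset.sum_add_distrib, Finset.sum_mul,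
    Finset.mul_sum]
  refine Finset.sum_congr rfl fun T _ => ?_
  simp only [← hqdef, Finset.prod_neg, Finset.prod_const_one]
  ring

end

section

/-! ### Comparison of the coefficients -/

/-- The involution d ↦ |n|/d on divisors. -/
theorem sigmaC_neg (ν : ℂ) (n : ℤ) :
    sigmaC (-ν) n = (n.natAbs : ℂ) ^ (-ν) * sigmaC ν n := by
  rw [sigmaC, sigmaC, ← Nat.sum_div_divisors, Finset.mul_sum]
  refine Finset.sum_congr rfl fun d hd => ?_
  have hdvd := Nat.dvd_of_mem_divisors hd
  have hd0 : (d : ℂ) ≠ 0 := by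
    exact_mod_cast (Nat.pos_of_mem_divisors hd).ne'
  have h1 : (n.natAbs : ℂ) ^ (-ν) = ((n.natAbs / d : ℕ) : ℂ) ^ (-ν) * (d : ℂ) ^ (-ν) := by
    rw [← natCast_mul_natCast_cpow, ← Nat.cast_mul, Nat.div_mul_cancel hdvd]
  rw [h1, mul_assoc, ← cpow_add _ _ hd0, neg_add_cancel, cpow_zero, mul_one]

theorem natCast_cpow_eq_sqrt {N : ℕ} (hN : N ≠ 0) (a : ℂ) :
    (N : ℂ) ^ a = ((√(N : ℝ) : ℝ) : ℂ) ^ (2 * a) := by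
  have hNpos : (0 : ℝ) < N := by exact_mod_cast Nat.pos_of_ne_zero hN
  have hr : 0 < √(N : ℝ) := Real.sqrt_pos.2 hNpos
  rw [two_mul, cpow_add _ _ (ofReal_ne_zero.2 hr.ne'), ← ofReal_mul_cpow hr, ← ofReal_mul,
    Real.mul_self_sqrt hNpos.le, ofReal_natCast]

theorem prod_one_sub_ne_zero (N : ℕ) {q : ℂ} (hq : 2 < q.re) :
    ∏ p ∈ N.primeFactors, (1 - (p : ℂ) ^ (-q)) ≠ 0 :=
  Finset.prod_ne_zero_iff.2 fun _ hp =>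
    one_sub_prime_cpow_ne_zero (Nat.prime_of_mem_primeFactors hp) (by rw [neg_re]; linarith)

/-- With G_v the geometric sum and G_{v+1} = 1 + p^{1-q} G_v, the factor 1 - p^{1-q} G_v/G_{v+1} is
1/G_{v+1}. Both products thus have denominator ∏ G_{v+1}, as in `fFactor_reflect`. -/
theorem localCoeff_of_ne_zero {N : ℕ} (hN : N ≠ 0) {k : ℤ} {s : ℂ} (hq : 2 < (2 * s + k).re)
    {n : ℤ} (hn : n ≠ 0) :
    localCoeff N (2 * s + k) n = (∏ p ∈ N.primeFactors, (1 - (p : ℂ) ^ (-(2 * s + k)))) *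
      (((√(N : ℝ) : ℝ) : ℂ) ^ (-(2 * s + k)) * fFactor N k n (1 - k - s)) := by
  have hr' : ((√(N : ℝ) : ℝ) : ℂ) ≠ 0 := ofReal_ne_zero.2
    (Real.sqrt_pos.2 (by exact_mod_cast Nat.pos_of_ne_zero hN)).ne'
  have hZ := prod_one_sub_ne_zero N hq
  rw [fFactor_reflect, localCoeff, natCast_cpow_eq_sqrt hN,
    show 2 * ((2 * s + (k : ℂ)) / 2) = 2 * s + k by ring]
  generalize hqdef : 2 * s + (k : ℂ) = q at *
  have hν : (1 - q).re < 0 := by rw [sub_re, one_re]; linarith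
  have hne : ∀ p ∈ N.primeFactors, geomFactor p (1 - q) (padicValInt p n + 1) ≠ 0 := fun p hp =>
    geomFactor_succ_ne_zero (Nat.prime_of_mem_primeFactors hp) hν _
  have hG : ∏ p ∈ N.primeFactors, geomFactor p (1 - q) (padicValInt p n + 1) ≠ 0 :=
    Finset.prod_ne_zero_iff.2 hne
  have h1 : ∏ p ∈ N.primeFactors, ((p : ℂ) ^ (1 - q) * sigmaRatio (1 - q) n p + -(p : ℂ) ^ (-q)) =
      (∏ p ∈ N.primeFactors, (-(p : ℂ) ^ (-q) * geomFactor p (1 - q) (padicValInt p n + 1) +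
        (p : ℂ) ^ (1 - q) * geomFactor p (1 - q) (padicValInt p n))) /
      ∏ p ∈ N.primeFactors, geomFactor p (1 - q) (padicValInt p n + 1) := by
    rw [← Finset.prod_div_distrib]
    refine Finset.prod_congr rfl fun p hp => ?_
    have := hne p hp
    rw [sigmaRatio, if_neg hn]
    field_simp
    ring
  have h2 : ∏ p ∈ N.primeFactors, (-((p : ℂ) ^ (1 - q) * sigmaRatio (1 - q) n p) + 1) =
      1 / ∏ p ∈ N.primeFactors, geomFactor p (1 - q) (padicValInt p n + 1) := by
    rw [one_div, ← Finset.prod_inv_distrib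
      (fun p => geomFactor p (1 - q) (padicValInt p n + 1))]
    apply Finset.prod_congr rfl
    intro p hp
    have h3 := hne p hp
    rw [sigmaRatio, if_neg hn]
    rw [geomFactor_succ'] at h3 ⊢
    field_simp
    ring
  have hrr : ((√(N : ℝ) : ℝ) : ℂ) ^ (-q) * ((√(N : ℝ) : ℝ) : ℂ) ^ q = 1 := by
    rw [← cpow_add _ _ hr', neg_add_cancel, cpow_zero]
  rw [h1, h2, Finset.prod_mul_distrib]
  set G := ∏ p ∈ N.primeFactors, geomFactor p (1 - q) (padicValInt p n + 1)
  set M := ∏ p ∈ N.primeFactors, (-(p : ℂ) ^ (-q) * geomFactor p (1 - q) (padicValInt p n + 1) +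
        (p : ℂ) ^ (1 - q) * geomFactor p (1 - q) (padicValInt p n))
  field_simp
  linear_combination (-M) * hrr

/-- All ratios are 1 at n = 0, and p^{1-q} - p^{-q} = p^{1-q}(1 - 1/p); squarefreeness turns ∏
p^{1-q} into N^{1-q}. -/
theorem localCoeff_zero {N : ℕ} (hN : N ≠ 0) (hsq : Squarefree N) (q : ℂ) :
    localCoeff N q 0 =
      ((√(N : ℝ) : ℝ) : ℂ) ^ (2 * (1 - q)) * ∏ p ∈ N.primeFactors, (1 - (p : ℂ)⁻¹) +
      ((√(N : ℝ) : ℝ) : ℂ) ^ (-q) * ∏ p ∈ N.primeFactors, (1 - (p : ℂ) ^ (1 - q)) := by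
  have h1 : ((√(N : ℝ) : ℝ) : ℂ) ^ (2 * (1 - q)) = ∏ p ∈ N.primeFactors, (p : ℂ) ^ (1 - q) := by
    rw [← natCast_cpow_eq_sqrt hN, ← natCast_prod_cpow, Nat.prod_primeFactors_of_squarefree hsq]
  have hA : ∏ p ∈ N.primeFactors, ((p : ℂ) ^ (1 - q) * sigmaRatio (1 - q) 0 p + -(p : ℂ) ^ (-q)) =
      ∏ p ∈ N.primeFactors, ((p : ℂ) ^ (1 - q) * (1 - (p : ℂ)⁻¹)) := by
    refine Finset.prod_congr rfl fun p hp => ?_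
    have hp0 : (p : ℂ) ≠ 0 := by exact_mod_cast (Nat.prime_of_mem_primeFactors hp).ne_zero
    rw [sigmaRatio, if_pos rfl, sub_eq_add_neg 1 q, cpow_add _ _ hp0, cpow_one]
    field_simp
    ring
  have hB : ∏ p ∈ N.primeFactors, (-((p : ℂ) ^ (1 - q) * sigmaRatio (1 - q) 0 p) + 1) =
      ∏ p ∈ N.primeFactors, (1 - (p : ℂ) ^ (1 - q)) := by
    refine Finset.prod_congr rfl fun p hp => ?_
    rw [sigmaRatio, if_pos rfl]
    ring
  rw [localCoeff, h1, ← Finset.prod_mul_distrib, hA, hB]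

/-- For n < 0 the reflection swaps the exponents s + k and s, which amounts to κ = -k/2. Both signs
thus take the form w ± κ at a positive frequency. -/
theorem fourier_eisKer_div {k : ℤ} (s : ℂ) (y r : ℝ) {n : ℤ} (hn : n ≠ 0) :
    𝓕 (eisKer (s + k) s y) (n / r) =
      𝓕 (eisKer (s + k / 2 + n.sign * k / 2) (s + k / 2 - n.sign * k / 2) y)
        ((|n| : ℤ) / r) := by
  rcases lt_or_gt_of_ne hn with h | h
  · rw [Int.sign_eq_neg_one_of_neg h, abs_of_neg h]
    push_cast
    rw [show s + (k : ℂ) / 2 + -1 * k / 2 = s by ring,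
      show s + (k : ℂ) / 2 - -1 * k / 2 = s + k by ring, neg_div, fourier_eisKer_neg]
  · rw [Int.sign_eq_one_of_pos h, abs_of_pos h]
    push_cast
    rw [show s + (k : ℂ) / 2 + 1 * k / 2 = s + k by ring,
      show s + (k : ℂ) / 2 - 1 * k / 2 = s by ring]

/-- The factor relating `Ĝ_{N,k}(z,s)` to the sum of `|w|^{-2s} w^{-k}`. -/
noncomputable def completionFactor (N : ℕ) (k : ℤ) (y : ℝ) (s : ℂ) : ℂ :=
  ((Real.pi / √(N : ℝ) : ℝ) : ℂ) ^ (-s - (k : ℂ) / 2) *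
    Gamma (s + (k : ℂ) / 2 + ((|k| : ℤ) : ℂ) / 2) * fFactor N k 1 s * (y : ℂ) ^ s

variable {N : ℕ} {k : ℤ} {s : ℂ}

theorem pi_div_sqrt_cpow (hN : N ≠ 0) (a : ℂ) : ((Real.pi / √(N : ℝ) : ℝ) : ℂ) ^ (-a) =
    (Real.pi : ℂ) ^ (-a) * ((√(N : ℝ) : ℝ) : ℂ) ^ a := by
  have hr : 0 < √(N : ℝ) := Real.sqrt_pos.2 (by exact_mod_cast Nat.pos_of_ne_zero hN)
  rw [div_eq_mul_inv, ofReal_mul, ofReal_mul_cpow Real.pi_pos, ofReal_inv, inv_cpow, cpow_neg _ a,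
    cpow_neg _ a, inv_inv]
  rw [arg_ofReal_of_nonneg hr.le]
  exact Real.pi_pos.ne

theorem fourierCoeffN_mul_exp (hN : N ≠ 0) (hq : 2 < (2 * s + k).re) (z : UpperHalfPlane)
    {n : ℤ} (hn : n ≠ 0) :
    fourierCoeffN N k z.im s n *
        cexp (2 * Real.pi * I * (n : ℤ) * z.re / (√(N : ℝ) : ℝ)) =
      completionFactor N k z.im s / (∏ p ∈ N.primeFactors, (1 - (p : ℂ) ^ (-(2 * s + k)))) *
      (sigmaExt (1 - (2 * s + k)) n * (localCoeff N (2 * s + k) n *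
        (((√(N : ℝ) : ℝ) : ℂ) ^ (2 * s + k - 1) * ((-1 : ℂ) ^ (k / 2) *
          fourierTerm (s + k) s z.im z.re (n / √(N : ℝ)))))) := by
  have hr : 0 < √(N : ℝ) := Real.sqrt_pos.2 (by exact_mod_cast Nat.pos_of_ne_zero hN)
  have hr' : ((√(N : ℝ) : ℝ) : ℂ) ≠ 0 := ofReal_ne_zero.2 hr.ne'
  have hy' : (z.im : ℂ) ≠ 0 := ofReal_ne_zero.2 z.im_pos.ne'
  have habs : (0 : ℝ) < (|n| : ℤ) := by exact_mod_cast abs_pos.2 hn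
  have habs' : (((|n| : ℤ) : ℝ) : ℂ) ≠ 0 := ofReal_ne_zero.2 habs.ne'
  set w : ℂ := s + k / 2 with hw
  have hw2 : 2 * s + (k : ℂ) = 2 * w := by rw [hw]; ring
  have hwre : 1 < w.re := by
    have : (2 * s + (k : ℂ)).re = 2 * w.re := by rw [hw2]; simp
    linarith
  set κ : ℂ := n.sign * k / 2 with hκ
  have hh : 0 < ((|n| : ℤ) : ℝ) / √(N : ℝ) := div_pos habs hr
  have hW := whittakerW_div_Gamma hwre κ hh z.im_pos
  have hZ := prod_one_sub_ne_zero N hq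
  have hσ : sigmaC (2 * s + k - 1) n =
      (((|n| : ℤ) : ℝ) : ℂ) ^ (2 * w - 1) * sigmaC (1 - (2 * s + k)) n := by
    have := sigmaC_neg (1 - (2 * s + k)) n
    rw [neg_sub] at this
    rw [this, hw2, ofReal_intCast, Int.abs_eq_natAbs, Int.cast_natCast]
  have hexp : cexp (2 * Real.pi * I * ((n / √(N : ℝ) : ℝ) : ℂ) * z.re) =
      cexp (2 * Real.pi * I * (n : ℤ) * z.re / (√(N : ℝ) : ℝ)) := by
    congr 1
    push_cast
    ring
  have hdiv : ((((|n| : ℤ) : ℝ) / √(N : ℝ) : ℝ) : ℂ) ^ (1 - w) =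
      (((|n| : ℤ) : ℝ) : ℂ) ^ (1 - w) * ((√(N : ℝ) : ℝ) : ℂ) ^ (w - 1) := by
    rw [div_eq_mul_inv, ofReal_mul, ofReal_mul_cpow habs, ofReal_inv, inv_cpow, ← cpow_neg, neg_sub]
    rw [arg_ofReal_of_nonneg hr.le]
    exact Real.pi_pos.ne
  have hn1 : (((|n| : ℤ) : ℝ) : ℂ) ^ (-w) * (((|n| : ℤ) : ℝ) : ℂ) ^ (2 * w - 1) *
      (((|n| : ℤ) : ℝ) : ℂ) ^ (1 - w) = 1 := by
    rw [← cpow_add _ _ habs', ← cpow_add _ _ habs', show -w + (2 * w - 1) + (1 - w) = 0 by ring,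
      cpow_zero]
  have hy1 : (z.im : ℂ) ^ (-(k : ℂ) / 2) * (z.im : ℂ) ^ w = (z.im : ℂ) ^ s := by
    rw [← cpow_add _ _ hy', show -(k : ℂ) / 2 + w = s by rw [hw]; ring]
  have hr1 : ((√(N : ℝ) : ℝ) : ℂ) ^ w * (((√(N : ℝ) : ℝ) : ℂ) ^ (-(2 * w)) *
      ((√(N : ℝ) : ℝ) : ℂ) ^ (2 * w - 1)) = ((√(N : ℝ) : ℝ) : ℂ) ^ (w - 1) := by
    rw [← cpow_add _ _ hr', ← cpow_add _ _ hr']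
    ring_nf
  have harg : 4 * Real.pi * ((|n| : ℤ) : ℝ) * (z.im / √(N : ℝ)) =
      4 * Real.pi * (((|n| : ℤ) : ℝ) / √(N : ℝ)) * z.im := by ring
  have hμ : s + ((k : ℂ) - 1) / 2 = w - 1 / 2 := by rw [hw]; ring
  rw [hdiv] at hW
  rw [fourierCoeffN, harg, hμ, hσ, localCoeff_of_ne_zero hN hq hn, completionFactor,
    show -s - (k : ℂ) / 2 = -w by rw [hw]; ring, pi_div_sqrt_cpow hN, fourierTerm,
    fourier_eisKer_div s z.im (√(N : ℝ)) hn, hexp, sigmaExt, if_neg hn, hw2, ← hw, ← hκ,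
    ← ofReal_intCast |n|]
  set W := whittakerW κ (w - 1 / 2) (4 * Real.pi * (((|n| : ℤ) : ℝ) / √(N : ℝ)) * z.im)
  set Φ := 𝓕 (eisKer (w + κ) (w - κ) z.im) (((|n| : ℤ) : ℝ) / √(N : ℝ))
  set E := cexp (2 * Real.pi * I * (n : ℤ) * z.re / (√(N : ℝ) : ℝ))
  set Z := ∏ p ∈ N.primeFactors, (1 - (p : ℂ) ^ (-(2 * s + k))) with hZdef
  rw [hw2] at hZdef
  rw [← hZdef, div_mul_eq_mul_div, eq_div_iff hZ]
  -- `hW` trades the Whittaker function for the Fourier transform; `hn1`, `hy1` and `hr1` match the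
  -- powers of |n|, y and √N.
  linear_combination (exp := 1)
    ((-1 : ℂ) ^ (k / 2) * (z.im : ℂ) ^ (-(k : ℂ) / 2) *
      Gamma (w + ((|k| : ℤ) : ℂ) / 2) * (((|n| : ℤ) : ℝ) : ℂ) ^ (-w) *
      (((|n| : ℤ) : ℝ) : ℂ) ^ (2 * w - 1) * sigmaC (1 - 2 * w) n * fFactor N k n (1 - k - s) *
      fFactor N k 1 s * E * Z) * hW +
    ((-1 : ℂ) ^ (k / 2) * (z.im : ℂ) ^ (-(k : ℂ) / 2) * (z.im : ℂ) ^ w *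
      Gamma (w + ((|k| : ℤ) : ℂ) / 2) * sigmaC (1 - 2 * w) n * fFactor N k n (1 - k - s) *
      fFactor N k 1 s * E * Z * ((√(N : ℝ) : ℝ) : ℂ) ^ (w - 1) * (Real.pi : ℂ) ^ (-w) * Φ) * hn1 +
    ((-1 : ℂ) ^ (k / 2) *
      Gamma (w + ((|k| : ℤ) : ℂ) / 2) * sigmaC (1 - 2 * w) n * fFactor N k n (1 - k - s) *
      fFactor N k 1 s * E * Z * ((√(N : ℝ) : ℝ) : ℂ) ^ (w - 1) * (Real.pi : ℂ) ^ (-w) * Φ) * hy1 -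
    ((-1 : ℂ) ^ (k / 2) * (z.im : ℂ) ^ s *
      Gamma (w + ((|k| : ℤ) : ℂ) / 2) * sigmaC (1 - 2 * w) n * fFactor N k n (1 - k - s) *
      fFactor N k 1 s * E * Z * (Real.pi : ℂ) ^ (-w) * Φ) * hr1

theorem completedRiemannZeta_reflect {q : ℂ} (hq : 2 < q.re) :
    completedRiemannZeta (2 - q) = Gammaℝ (q - 1) * riemannZeta (q - 1) := by
  have h0 : q - 1 ≠ 0 := by
    intro h
    have := congrArg re h
    simp at this
    linarith
  rw [show 2 - q = 1 - (q - 1) by ring, completedRiemannZeta_one_sub, riemannZeta_def_of_ne_zero h0,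
    mul_div_cancel₀]
  exact Gammaℝ_ne_zero_of_re_pos (by rw [sub_re, one_re]; linarith)

/-- The ζ(q) term supplies y^s. The frequency 0 carries ζ(q-1) and Γ(2w-1)/(Γ(s+k)Γ(s)); duplication
splits Γ(2w-1) into Γ(w-1/2)Γ(w), and Γ(w-1/2) completes ζ(q-1), which the functional equation turns
into ζ̂(2-q). -/
theorem constTerm_eq (hN : N ≠ 0) (hsq : Squarefree N) (hq : 2 < (2 * s + k).re)
    (z : UpperHalfPlane) :
    constTerm N k z.im s = completionFactor N k z.im s * riemannZeta (2 * s + k) +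
      completionFactor N k z.im s / (∏ p ∈ N.primeFactors, (1 - (p : ℂ) ^ (-(2 * s + k)))) *
      (sigmaExt (1 - (2 * s + k)) 0 * (localCoeff N (2 * s + k) 0 *
        (((√(N : ℝ) : ℝ) : ℂ) ^ (2 * s + k - 1) * ((-1 : ℂ) ^ (k / 2) *
          fourierTerm (s + k) s z.im z.re ((0 : ℤ) / √(N : ℝ)))))) := by
  have hr' : ((√(N : ℝ) : ℝ) : ℂ) ≠ 0 := ofReal_ne_zero.2
    (Real.sqrt_pos.2 (by exact_mod_cast Nat.pos_of_ne_zero hN)).ne'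
  have hy := z.im_pos
  have hy' : (z.im : ℂ) ≠ 0 := ofReal_ne_zero.2 hy.ne'
  have hpi : (Real.pi : ℂ) ≠ 0 := ofReal_ne_zero.2 Real.pi_ne_zero
  have hZ := prod_one_sub_ne_zero N hq
  have hrefl := completedRiemannZeta_reflect hq
  set w : ℂ := s + k / 2 with hw
  have hw2 : 2 * s + (k : ℂ) = 2 * w := by rw [hw]; ring
  have hwre : 1 < w.re := by
    have : (2 * s + (k : ℂ)).re = 2 * w.re := by rw [hw2]; simp
    linarith
  have hΓw : Gamma w ≠ 0 := Gamma_ne_zero_of_re_pos (by linarith)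
  have hζ : completedRiemannZeta (2 * w) =
      (Real.pi : ℂ) ^ (-w) * Gamma w * riemannZeta (2 * w) := by
    have h0 : 2 * w ≠ 0 := by
      intro h
      have := congrArg re h
      simp at this
      linarith
    have hG := Gammaℝ_ne_zero_of_re_pos (s := 2 * w) (by simp; linarith)
    rw [riemannZeta_def_of_ne_zero h0, mul_div_assoc', eq_div_iff hG, Gammaℝ_def]
    rw [show -(2 * w) / 2 = -w by ring, show 2 * w / 2 = w by ring]
    ring
  have hF := fourier_eisKer_zero hwre ((k : ℂ) / 2) hy
  rw [show w + (k : ℂ) / 2 = s + k by rw [hw]; ring,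
    show w - (k : ℂ) / 2 = s by rw [hw]; ring] at hF
  have hdup := Gamma_mul_Gamma_add_half (w - 1 / 2)
  rw [show w - 1 / 2 + 1 / 2 = w by ring, show 2 * (w - 1 / 2) = 2 * w - 1 by ring,
    show 1 - (2 * w - 1) = 2 - 2 * w by ring] at hdup
  -- Matches the powers of 2, π and y: the left side comes from `fourier_eisKer_zero` and the
  -- completion factor, the right side from duplication and the archimedean factor of ζ̂.
  have hpow : (z.im : ℂ) ^ s * (Real.pi : ℂ) ^ (-w) * ((2 * Real.pi : ℝ) : ℂ) ^ (2 * w) *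
      ((4 * Real.pi * z.im : ℝ) : ℂ) ^ (1 - 2 * w) =
      (2 : ℂ) ^ (2 - 2 * w) * ((√Real.pi : ℝ) : ℂ) * (Real.pi : ℂ) ^ (-(2 * w - 1) / 2) *
        (z.im : ℂ) ^ (1 - k - s) := by
    have h4 : (4 : ℂ) ^ (1 - 2 * w) = (2 : ℂ) ^ (2 * (1 - 2 * w)) := by
      have := natCast_mul_natCast_cpow 2 2 (1 - 2 * w)
      norm_num at this
      rw [this, two_mul (1 - 2 * w), cpow_add _ _ two_ne_zero]
    have hs2 : ((√Real.pi : ℝ) : ℂ) = (Real.pi : ℂ) ^ (1 / 2 : ℂ) := by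
      rw [Real.sqrt_eq_rpow, ofReal_cpow Real.pi_pos.le]
      norm_num
    rw [ofReal_mul 2, ofReal_mul_cpow two_pos, ofReal_mul, ofReal_mul_cpow (by positivity),
      ofReal_mul, ofReal_mul_cpow (by positivity), hs2]
    push_cast
    rw [h4]
    have e1 : (2 : ℂ) ^ (2 * w) * (2 : ℂ) ^ (2 * (1 - 2 * w)) = (2 : ℂ) ^ (2 - 2 * w) := by
      rw [← cpow_add _ _ two_ne_zero]; ring_nf
    have e2 : (Real.pi : ℂ) ^ (-w) * (Real.pi : ℂ) ^ (2 * w) * (Real.pi : ℂ) ^ (1 - 2 * w) =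
        (Real.pi : ℂ) ^ (1 / 2 : ℂ) * (Real.pi : ℂ) ^ (-(2 * w - 1) / 2) := by
      rw [← cpow_add _ _ hpi, ← cpow_add _ _ hpi, ← cpow_add _ _ hpi]; ring_nf
    have e3 : (z.im : ℂ) ^ s * (z.im : ℂ) ^ (1 - 2 * w) = (z.im : ℂ) ^ (1 - k - s) := by
      rw [← cpow_add _ _ hy', hw]; ring_nf
    rw [← e1, ← e3]
    linear_combination ((z.im : ℂ) ^ s * (z.im : ℂ) ^ (1 - 2 * w) * (2 : ℂ) ^ (2 * w) *
      (2 : ℂ) ^ (2 * (1 - 2 * w))) * e2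
  have hr1 : ((√(N : ℝ) : ℝ) : ℂ) ^ w * (((√(N : ℝ) : ℝ) : ℂ) ^ (2 * (1 - 2 * w)) *
      ((√(N : ℝ) : ℝ) : ℂ) ^ (2 * w - 1)) = ((√(N : ℝ) : ℝ) : ℂ) ^ (1 - w) := by
    rw [← cpow_add _ _ hr', ← cpow_add _ _ hr']
    ring_nf
  have hr2 : ((√(N : ℝ) : ℝ) : ℂ) ^ w * (((√(N : ℝ) : ℝ) : ℂ) ^ (-(2 * w)) *
      ((√(N : ℝ) : ℝ) : ℂ) ^ (2 * w - 1)) = ((√(N : ℝ) : ℝ) : ℂ) ^ (w - 1) := by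
    rw [← cpow_add _ _ hr', ← cpow_add _ _ hr']
    ring_nf
  have hT : fourierTerm (s + k) s z.im z.re ((0 : ℤ) / √(N : ℝ)) =
      𝓕 (eisKer (s + k) s z.im) 0 := by
    simp [fourierTerm]
  have x1 : -2 * s - (k : ℂ) = -(2 * w) := by rw [← hw2]; ring
  have x2 : (1 : ℂ) - k - 2 * s = 1 - 2 * w := by rw [← hw2]; ring
  have x3 : (2 : ℂ) - k - 2 * s = 2 - 2 * w := by rw [← hw2]; ring
  have x4 : 1 - s - (k : ℂ) / 2 = 1 - w := by rw [hw]; ring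
  have x5 : -1 + s + (k : ℂ) / 2 = w - 1 := by rw [hw]; ring
  have x6 : -s - (k : ℂ) / 2 = -w := by rw [hw]; ring
  rw [hw2] at hrefl hZ ⊢
  rw [Gammaℝ_def, show (2 * w - 1) / 2 = w - 1 / 2 by ring] at hrefl
  rw [constTerm, completionFactor, hT, hF, localCoeff_zero hN hsq, sigmaExt, if_pos rfl, neg_sub,
    x1, x2, x3, x4, x5, x6, pi_div_sqrt_cpow hN, hw2, ← hw, hζ, hrefl, Finset.prod_div_distrib,
    Finset.prod_div_distrib]
  set Z := ∏ p ∈ N.primeFactors, (1 - (p : ℂ) ^ (-(2 * w)))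
  set A := ∏ p ∈ N.primeFactors, (1 - (p : ℂ)⁻¹)
  set B := ∏ p ∈ N.primeFactors, (1 - (p : ℂ) ^ (1 - 2 * w))
  rw [← hr1, ← hr2]
  set K := Gamma (w + ((|k| : ℤ) : ℂ) / 2)
  have hcancel : K / Gamma w * ((Real.pi : ℂ) ^ (-w) * Gamma w * riemannZeta (2 * w)) =
      K * (Real.pi : ℂ) ^ (-w) * riemannZeta (2 * w) := by
    field_simp
  set r := ((√(N : ℝ) : ℝ) : ℂ)
  set c := (-1 : ℂ) ^ (k / 2) * K * (Gamma (s + k))⁻¹ * (Gamma s)⁻¹ * riemannZeta (2 * w - 1) *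
    fFactor N k 1 s * Z⁻¹ * (r ^ w * (r ^ (2 * (1 - 2 * w)) * r ^ (2 * w - 1)) * A +
      r ^ w * (r ^ (-(2 * w)) * r ^ (2 * w - 1)) * B)
  linear_combination ((z.im : ℂ) ^ s * r ^ w * fFactor N k 1 s) * hcancel +
    (c * (Real.pi : ℂ) ^ (-(2 * w - 1) / 2) * (z.im : ℂ) ^ (1 - k - s)) * hdup -
    (c * Gamma (2 * w - 1)) * hpow

/-- The Fourier expansion as an unconditionally convergent sum over all integers. -/
theorem hasSum_eisensteinGHat (hN : 1 < N) (hsq : Squarefree N) (hk : Even k)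
    (hq : 2 < (2 * s + k).re) (z : UpperHalfPlane) :
    HasSum (fun n : {n : ℤ // n ≠ 0} => fourierCoeffN N k z.im s n *
        cexp (2 * Real.pi * I * (n : ℤ) * z.re / (√(N : ℝ) : ℝ)))
      (eisensteinGHat N k z s - constTerm N k z.im s) := by
  have hN0 : N ≠ 0 := by omega
  have hZ := prod_one_sub_ne_zero N hq
  have key := (hasSum_eisenstein hN hsq hk hq z).mul_left (completionFactor N k z.im s /
    (∏ p ∈ N.primeFactors, (1 - (p : ℂ) ^ (-(2 * s + k)))))
  rw [← mul_assoc, div_mul_cancel₀ _ hZ] at key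
  set F : ℤ → ℂ := fun n => completionFactor N k z.im s /
      (∏ p ∈ N.primeFactors, (1 - (p : ℂ) ^ (-(2 * s + k)))) *
      (sigmaExt (1 - (2 * s + k)) n * (localCoeff N (2 * s + k) n *
        (((√(N : ℝ) : ℝ) : ℂ) ^ (2 * s + k - 1) * ((-1 : ℂ) ^ (k / 2) *
          fourierTerm (s + k) s z.im z.re (n / √(N : ℝ)))))) with hF
  set S : ℂ := ∑' x : pairsL N, eisPhi k s (((√(N : ℝ) : ℝ) : ℂ) * x.1.1 * z + x.1.2) +
          ∑' x : pairsR N, eisPhi k s ((x.1.1 : ℂ) * z + ((√(N : ℝ) : ℝ) : ℂ) * x.1.2) with hS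
  have hG : completionFactor N k z.im s * S / 2 = eisensteinGHat N k z s := by
    rw [hS, eisensteinGHat, eisensteinG, eisensteinGL, eisensteinGR, completionFactor]
    simp only [eisTermL, eisTermR, eisTerm_eq, tsum_mul_left]
    ring
  have hconst : constTerm N k z.im s =
      completionFactor N k z.im s * riemannZeta (2 * s + k) + F 0 :=
    constTerm_eq hN0 hsq hq z
  -- The n = 0 term is removed from the series, since `constTerm_eq` already counts it in the
  -- constant term.
  have h1 := key.sub (hasSum_ite_eq (0 : ℤ) (F 0))
  have h2 : HasSum ({n : ℤ | n ≠ 0}.indicator F)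
      (eisensteinGHat N k z s - constTerm N k z.im s) := by
    have e1 : {n : ℤ | n ≠ 0}.indicator F = fun n => F n - if n = 0 then F 0 else 0 := by
      funext n
      by_cases hn : n = 0
      · simp [hn]
      · rw [indicator_of_mem (show n ∈ {n : ℤ | n ≠ 0} from hn), if_neg hn, sub_zero]
    rw [e1, hconst, ← hG, show completionFactor N k z.im s * S / 2 -
      (completionFactor N k z.im s * riemannZeta (2 * s + k) + F 0) =
      completionFactor N k z.im s * (S / 2 - riemannZeta (2 * s + k)) - F 0 by ring]
    exact h1
  refine (hasSum_subtype_iff_indicator.2 h2).congr_fun fun n => ?_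
  exact fourierCoeffN_mul_exp hN0 hq z n.2

end

end RNEisenstein

/-! ### The Fourier expansion -/

theorem corollary1p3 (N : ℕ) (hN : 1 < N) (hsq : Squarefree N) (k : ℤ) (hk : Even k)
    (z : UpperHalfPlane) (s : ℂ) (hs : 1 - (k : ℝ) / 2 < s.re) :
    Summable (RNEisenstein.eisTermL N k z s) ∧
    Summable (RNEisenstein.eisTermR N k z s) ∧
    Summable (fun n : {n : ℤ // n ≠ 0} =>
      RNEisenstein.fourierCoeffN N k z.im s n *
        Complex.exp (2 * Real.pi * Complex.I * (n : ℤ) * z.re / (√(N : ℝ) : ℝ))) ∧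
    RNEisenstein.eisensteinGHat N k z s =
      RNEisenstein.constTerm N k z.im s +
        ∑' n : {n : ℤ // n ≠ 0},
          RNEisenstein.fourierCoeffN N k z.im s n *
            Complex.exp (2 * Real.pi * Complex.I * (n : ℤ) * z.re / (√(N : ℝ) : ℝ)) := by
  have hq : 2 < (2 * s + k).re := by
    simp
    linarith
  have hN0 : N ≠ 0 := by omega
  have key := RNEisenstein.hasSum_eisensteinGHat hN hsq hk hq z
  refine ⟨?_, ?_, key.summable, ?_⟩
  · refine (((RNEisenstein.summable_eisPhi_left hN0 hq z).subtype _).mul_left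
      ((z.im : ℂ) ^ s)).congr fun p => ?_
    rw [RNEisenstein.eisTermL, RNEisenstein.eisTerm_eq]
    rfl
  · refine (((RNEisenstein.summable_eisPhi_right hN0 hq z).subtype _).mul_left
      ((z.im : ℂ) ^ s)).congr fun p => ?_
    rw [RNEisenstein.eisTermR, RNEisenstein.eisTerm_eq]
    rfl
  · rw [key.tsum_eq]
    ring
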